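/- **Setting.** Let $(X,Y)$ be a random vector with values in $[0,1]\times\mathbb R$ and $\mathbb E|Y|<\infty$, let $\mu:[0,1]\to\mathbb R$ be nonincreasing with $\mathbb E(Y\mid X)=\mu(X)$ a.s., and put $\epsilon=Y-\mu(X)$. Assume that $X$ has a density $f$ on $[0,1]$, that $\mu$ is differentiable on $[0,1]$ (one-sidedly at the end points), and that there are positive numbers $A_1,\dots,A_5,K,\alpha$ such that $$A_1<|\mu'(t)|<A_2,\qquad A_3<f(t)<A_4,\qquad |\mu(t)|\le A_5\qquad\text{for all }t\in[0,1],$$ $$\mathbb E\bigl(e^{\theta\epsilon}\mid X\bigr)\le K e^{\theta^2\alpha}\quad\text{a.s., for every }\theta\in\mathbb R .$$ For $n\ge 1$ let $(X_1,Y_1),\dots,(X_n,Y_n)$ be independent copies of $(X,Y)$, and let $X_{(1)}<\dots<X_{(n)}$ be the ordered design points (a.s. distinct). Let $\hat\mu_n$ be the isotonic least-squares estimator, that is, the nonincreasing function on $[0,1]$ that minimises $\sum_{i=1}^n(Y_i-\psi(X_i))^2$ over all nonincreasing $\psi:[0,1]\to\mathbb R$ and that is constant on $[0,X_{(1)}]$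 and on each $(X_{(i-1)},X_{(i)}]$, $2\le i\le n$, and equal to $\hat\mu_n(X_{(n)})$ on $[X_{(n)},1]$. For a nonincreasing left-continuous $h:[0,1]\to\mathbb R$ and $a\in\mathbb R$, let $h^{-1}(a)$ be the greatest $t\in[0,1]$ with $h(t)\ge a$, and $h^{-1}(a)=0$ if there is no such $t$. **Theorem.** For every real $p\ge1$ there exists $K_p>0$, depending only on $p,A_1,\dots,A_5,K,\alpha$, such that for all $n\ge1$ the following expectations are finite and satisfy 1. $\mathbb E\bigl(|\hat\mu_n^{-1}(a)-\mu^{-1}(a)|^p\bigr)\le K_p\,n^{-p/3}$ for all $a\in\mathbb R$; 2. $\mathbb E\bigl(|\hat\mu_n(t)-\mu(t)|^p\bigr)\le K_p\,n^{-p/3}$ for all $t\in[n^{-1/3},\,1-n^{-1/3}]$. -/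

import Mathlib

open MeasureTheory ProbabilityTheory Set

/-- `h` is a least-squares estimator of a nonincreasing regression function on `[0,1]` from the
data `(x i, y i)`: it is nonincreasing on `[0,1]` and minimises the residual sum of squares among
all functions that are nonincreasing on `[0,1]`. -/
def IsIsotonicLSE {n : ℕ} (x y : Fin n → ℝ) (h : ℝ → ℝ) : Prop :=
  AntitoneOn h (Icc 0 1) ∧
    ∀ ψ : ℝ → ℝ, AntitoneOn ψ (Icc 0 1) →
      ∑ i, (y i - h (x i)) ^ 2 ≤ ∑ i, (y i - ψ (x i)) ^ 2

/-- `h` is the left-continuous step function on `[0,1]` with jumps at design points only. In terms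
of the order statistics `x₍₁₎ < ⋯ < x₍ₙ₎`, it is constant on `[0, x₍₁₎]`, on each
`(x₍ᵢ₋₁₎, x₍ᵢ₎]`, and keeps its value at `x₍ₙ₎` on `[x₍ₙ₎, 1]`. -/
def IsDesignStep {n : ℕ} (x : Fin n → ℝ) (h : ℝ → ℝ) : Prop :=
  (∀ i, ∀ t ∈ Icc (0 : ℝ) 1, t ≤ x i → (∀ j, x j < x i → x j < t) → h t = h (x i)) ∧
    ∀ i, ∀ t ∈ Icc (0 : ℝ) 1, x i ≤ t → (∀ j, x j ≤ x i) → h t = h (x i)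

theorem exists_design_index {n : ℕ} (hn : 1 ≤ n) (x : Fin n → ℝ) (t : ℝ) :
    ∃ i, (t ≤ x i ∧ ∀ j, t ≤ x j → x i ≤ x j) ∨ ((∀ j, x j < t) ∧ ∀ j, x j ≤ x i) := by
  have : Nonempty (Fin n) := ⟨⟨0, hn⟩⟩
  by_cases ht : ∃ i, t ≤ x i
  · obtain ⟨i, hi⟩ := ht
    obtain ⟨k, hk, hmin⟩ := Finset.exists_min_image (Finset.univ.filter fun i => t ≤ x i) x
      ⟨i, by simpa using hi⟩
    exact ⟨k, Or.inl ⟨by simpa using hk, fun j hj => hmin j (by simpa using hj)⟩⟩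
  · push Not at ht
    obtain ⟨k, _, hmax⟩ := Finset.exists_max_image Finset.univ x Finset.univ_nonempty
    exact ⟨k, Or.inr ⟨ht, fun j => hmax j (Finset.mem_univ j)⟩⟩

/-- A step-function isotonic least-squares estimator exists. -/
theorem exists_isotonicLSE {n : ℕ} (x y : Fin n → ℝ) (hx : ∀ i, x i ∈ Icc (0 : ℝ) 1) :
    ∃ h, IsIsotonicLSE x y h ∧ IsDesignStep x h := by
  rcases Nat.eq_zero_or_pos n with rfl | hn
  · exact ⟨fun _ => 0, ⟨fun _ _ _ _ _ => le_rfl, fun _ _ => by simp⟩,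
      fun i => i.elim0, fun i => i.elim0⟩
  let C : Set (EuclideanSpace ℝ (Fin n)) := {θ | ∀ i j, x i ≤ x j → θ j ≤ θ i}
  have hC : IsClosed C := by
    have : C = ⋂ i, ⋂ j, ⋂ (_ : x i ≤ x j), {θ : EuclideanSpace ℝ (Fin n) | θ j ≤ θ i} := by
      ext θ; simp [C]
    rw [this]
    exact isClosed_iInter fun i => isClosed_iInter fun j => isClosed_iInter fun _ =>
      isClosed_le (by fun_prop) (by fun_prop)
  have hconv : Convex ℝ C := by
    intro θ hθ η hη a b ha hb _ i j hij
    have h1 := hθ i j hij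
    have h2 := hη i j hij
    simp only [PiLp.add_apply, PiLp.smul_apply, smul_eq_mul]
    nlinarith [mul_le_mul_of_nonneg_left h1 ha, mul_le_mul_of_nonneg_left h2 hb]
  obtain ⟨θ, hθC, hθ⟩ := exists_norm_eq_iInf_of_complete_convex
    (⟨0, fun _ _ _ => le_rfl⟩ : C.Nonempty) hC.isComplete hconv (WithLp.toLp 2 y)
  have hmin : ∀ η ∈ C, ∑ i, (y i - θ i) ^ 2 ≤ ∑ i, (y i - η i) ^ 2 := by
    intro η hη
    have h1 : ‖WithLp.toLp 2 y - θ‖ ≤ ‖WithLp.toLp 2 y - η‖ := by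
      rw [hθ]
      exact ciInf_le (f := fun w : C => ‖WithLp.toLp 2 y - (w : EuclideanSpace ℝ (Fin n))‖)
        ⟨0, by rintro _ ⟨w, rfl⟩; exact norm_nonneg _⟩ ⟨η, hη⟩
    have h2 := pow_le_pow_left₀ (norm_nonneg _) h1 2
    simpa [EuclideanSpace.norm_sq_eq] using h2
  choose I hI using exists_design_index hn x
  have heq : ∀ i j, x i = x j → θ i = θ j := fun i j hij =>
    le_antisymm (hθC j i hij.ge) (hθC i j hij.le)
  have hxi : ∀ i, θ (I (x i)) = θ i := by
    intro i
    rcases hI (x i) with ⟨h1, h2⟩ | ⟨h1, _⟩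
    · exact heq _ _ (le_antisymm (h2 i le_rfl) h1)
    · exact absurd (h1 i) (lt_irrefl _)
  refine ⟨fun t => θ (I t), ⟨?_, ?_⟩, ?_, ?_⟩
  · intro s _ t _ hst
    refine hθC _ _ ?_
    rcases hI s with ⟨h1, h2⟩ | ⟨h1, h2⟩ <;> rcases hI t with ⟨h3, h4⟩ | ⟨h3, h4⟩
    · exact h2 _ (hst.trans h3)
    · exact h4 _
    · linarith [h1 (I t)]
    · exact h4 _
  · intro ψ hψ
    simp only [hxi]
    exact hmin (WithLp.toLp 2 fun i => ψ (x i)) fun i j hij => hψ (hx i) (hx j) hij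
  · intro i t _ hti hj
    simp only [hxi]
    rcases hI t with ⟨h1, h2⟩ | ⟨h1, _⟩
    · refine heq _ _ (le_antisymm (h2 i hti) ?_)
      by_contra hlt
      linarith [hj _ (not_le.1 hlt)]
    · linarith [h1 i]
  · intro i t _ hit hmax
    simp only [hxi]
    rcases hI t with ⟨h1, _⟩ | ⟨_, h2⟩
    · exact heq _ _ (le_antisymm (hmax _) (hit.trans h1))
    · exact heq _ _ (le_antisymm (hmax _) (h2 i))

/-- The step-function isotonic least-squares estimator is unique on `[0,1]`. -/
theorem isotonicLSE_unique {n : ℕ} (hn : 1 ≤ n) (x y : Fin n → ℝ) {h k : ℝ → ℝ}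
    (hh : IsIsotonicLSE x y h ∧ IsDesignStep x h) (hk : IsIsotonicLSE x y k ∧ IsDesignStep x k) :
    EqOn h k (Icc 0 1) := by
  obtain ⟨⟨h1, h2⟩, h3, h4⟩ := hh
  obtain ⟨⟨k1, k2⟩, k3, k4⟩ := hk
  have key : ∀ i, h (x i) = k (x i) := by
    have hm : AntitoneOn (fun t => (h t + k t) / 2) (Icc 0 1) := fun s hs t ht hst => by
      have := h1 hs ht hst
      have := k1 hs ht hst
      simp only
      linarith
    have e1 := h2 _ hm
    have e2 := k2 _ hm
    have e3 : ∑ i, ((h (x i) - k (x i)) ^ 2) / 2 =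
        ∑ i, (y i - h (x i)) ^ 2 + ∑ i, (y i - k (x i)) ^ 2
          - 2 * ∑ i, (y i - (h (x i) + k (x i)) / 2) ^ 2 := by
      rw [Finset.mul_sum, ← Finset.sum_add_distrib, ← Finset.sum_sub_distrib]
      exact Finset.sum_congr rfl fun i _ => by ring
    have e4 : ∑ i, ((h (x i) - k (x i)) ^ 2) / 2 = 0 :=
      le_antisymm (by linarith) (Finset.sum_nonneg fun i _ => by positivity)
    rw [Finset.sum_eq_zero_iff_of_nonneg (fun i _ => by positivity)] at e4
    intro i
    have := e4 i (Finset.mem_univ i)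
    have h0 : (h (x i) - k (x i)) ^ 2 = 0 := by linarith
    exact sub_eq_zero.1 (pow_eq_zero_iff (two_ne_zero) |>.1 h0)
  intro t ht
  obtain ⟨i, ⟨a, b⟩ | ⟨a, b⟩⟩ := exists_design_index hn x t
  · have hj : ∀ j, x j < x i → x j < t := fun j hj => by
      by_contra hlt
      linarith [b j (not_lt.1 hlt)]
    rw [h3 i t ht a hj, k3 i t ht a hj, key]
  · rw [h4 i t ht (a i).le b, k4 i t ht (a i).le b, key]

open Classical in
/-- The piecewise-constant left-continuous isotonic least-squares estimator computed from the data
`(x i, y i)`. For design points in `[0,1]` it exists and is unique on `[0,1]` (proved above). -/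
noncomputable def isotonicLSE {n : ℕ} (x y : Fin n → ℝ) : ℝ → ℝ :=
  if H : ∃ h, IsIsotonicLSE x y h ∧ IsDesignStep x h then H.choose else 0

/-- Generalized inverse of a nonincreasing left-continuous function `h` on `[0,1]`: the greatest
`t ∈ [0,1]` with `h t ≥ a`, and `0` if there is none (`sSup ∅ = 0` in `ℝ`). -/
noncomputable def genInv (h : ℝ → ℝ) (a : ℝ) : ℝ :=
  sSup {t | t ∈ Icc (0 : ℝ) 1 ∧ a ≤ h t}

/-- The random variable `X` takes values in `[0,1]` almost surely and has density `f` there. -/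
def HasUnitDensity {Ω : Type*} [MeasurableSpace Ω] (P : Measure Ω) (X : Ω → ℝ) (f : ℝ → ℝ) :
    Prop :=
  AEMeasurable f (volume.restrict (Icc (0 : ℝ) 1)) ∧
    P.map X = (volume.restrict (Icc (0 : ℝ) 1)).withDensity fun t => ENNReal.ofReal (f t)

/-- `μ(X) = E(Y | X)`. -/
def IsRegressionFunction {Ω : Type*} [MeasurableSpace Ω] (P : Measure Ω) (X Y : Ω → ℝ)
    (μ : ℝ → ℝ) : Prop :=
  Integrable Y P ∧ P[Y | MeasurableSpace.comap X inferInstance] =ᵐ[P] fun ω => μ (X ω)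

/-- With `ε = Y - μ(X)`: for every real `θ`, `E(exp (θ ε) | X) ≤ K exp (θ² α)` almost surely. -/
def HasSubGaussianErrors {Ω : Type*} [MeasurableSpace Ω] (P : Measure Ω) (X Y : Ω → ℝ)
    (μ : ℝ → ℝ) (K α : ℝ) : Prop :=
  ∀ θ : ℝ, Integrable (fun ω => Real.exp (θ * (Y ω - μ (X ω)))) P ∧
    ∀ᵐ ω ∂P, (P[fun ω => Real.exp (θ * (Y ω - μ (X ω))) |
      MeasurableSpace.comap X inferInstance]) ω ≤ K * Real.exp (θ ^ 2 * α)

/-- `W 0, …, W (n-1)` are independent copies of `(X, Y)`. -/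
def IsIIDSample {Ω : Type*} [MeasurableSpace Ω] (P : Measure Ω) (X Y : Ω → ℝ) {n : ℕ}
    (W : Fin n → Ω → ℝ × ℝ) : Prop :=
  iIndepFun W P ∧ ∀ i, IdentDistrib (W i) (fun ω => (X ω, Y ω)) P P

/-- The random function `μ̂ₙ`: the isotonic least-squares estimator of the sample `W`. -/
noncomputable def muHat {Ω : Type*} {n : ℕ} (W : Fin n → Ω → ℝ × ℝ) (ω : Ω) : ℝ → ℝ :=
  isotonicLSE (fun i => (W i ω).1) (fun i => (W i ω).2)

/-! Both bounds come from exponential tails at scale n^(-1/3), integrated over the level. Only upper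
deviations need work, since the substitution (x, y) ↦ (1 - x, -y) exchanges them with lower ones.

Suppose the estimator is at least `a` at `t`. Lowering it slightly on the part of its upper level
set to the right of a cut-off `t₀` cannot decrease the residual sum of squares, so Σ (Yᵢ - a) ≥ 0
over that part (`sum_upper_nonneg`). The indices involved are the design points from `t₀` up to a
random end, and they include all those in [t₀, t]. If a ≥ μ(t₀), the drift a - μ(Xᵢ) is at least A₁
(Xᵢ - t₀), so a partial sum of errors, taken in design order, must exceed a barrier.

The end point is random, so a maximal inequality is needed. Given the design, exp(θ Σ (εᵢ - κθ)) is
a supermartingale in design order, and the barrier is exceeded somewhere with probability at most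
exp(-θ · barrier). A barrier of the form β₀ + Σ β(Xᵢ) over the whole sample makes the average over
the design an n-th power of E exp(-θ β(X)) (`pi_exists_lowerSet_error_sum_le`). With θ proportional
to v = t - t₀ this expectation is at most 1 - c v³, whence the tail exp(-c n v³)
(`exists_pi_le_apply_add_le`).

For the inverse this is the required tail. For the pointwise error, a deviation z is converted into
the distance v = z / (2A₂) when this fits to the left of `t`. Otherwise the level exceeds all
regression values by z/2, and the number of design points in [0, t] controls the probability; there
t ≥ n^(-1/3) supplies the rate. -/

/-! ### Level sets of the least-squares estimator -/

/-- Subtracting `a` on an upper level set of the least-squares estimator, cut off at `t₀`, leaves a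
nonnegative sum of residuals. -/
theorem IsIsotonicLSE.sum_upper_nonneg {n : ℕ} {x y : Fin n → ℝ} {h : ℝ → ℝ}
    (hh : IsIsotonicLSE x y h) (t₀ a : ℝ) :
    0 ≤ ∑ i ∈ Finset.univ.filter (fun i => t₀ ≤ x i ∧ a ≤ h (x i)), (y i - h (x i)) := by
  classical
  -- There are finitely many fitted values, so those below `a` leave a gap (a', a) in which the
  -- others can be lowered.
  obtain ⟨a', ha', hlt⟩ : ∃ a' < a, ∀ i, h (x i) < a → h (x i) ≤ a' := by
    by_cases hne : (Finset.univ.filter fun i => h (x i) < a).Nonempty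
    · obtain ⟨k, hk, hmax⟩ := Finset.exists_max_image _ (fun i => h (x i)) hne
      exact ⟨h (x k), by simpa using hk, fun i hi => hmax i (by simpa using hi)⟩
    · rw [Finset.not_nonempty_iff_eq_empty, Finset.filter_eq_empty_iff] at hne
      exact ⟨a - 1, by linarith, fun i hi => absurd hi (hne (Finset.mem_univ i))⟩
  set A := Finset.univ.filter (fun i => t₀ ≤ x i ∧ a ≤ h (x i)) with hA
  have key : ∀ δ : ℝ, 0 < δ → δ ≤ a - a' → 0 ≤ 2 * ∑ i ∈ A, (y i - h (x i)) + δ * A.card := by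
    intro δ hδ hδa
    -- Monotone truncation: it shifts values at least `a` by `δ` and fixes values at most `a'`. As φ
    -- ≤ id, applying it only from `t₀` on keeps the function nonincreasing.
    let φ : ℝ → ℝ := fun r => max (r - δ) (min r a')
    have hφm : Monotone φ := fun r s hrs =>
      max_le_max (by linarith) (min_le_min_right _ hrs)
    have hφle : ∀ r, φ r ≤ r := fun r => max_le (by linarith) (min_le_left _ _)
    have h1 := hh.2 (fun t => if t < t₀ then h t else φ (h t)) (by
      intro s hs t ht hst
      have := hh.1 hs ht hst
      dsimp only
      split_ifs with h1 h2 h2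
      · exact this
      · linarith
      · exact (hφle _).trans this
      · exact hφm this)
    have h2 : ∀ i, (y i - (fun t => if t < t₀ then h t else φ (h t)) (x i)) ^ 2 =
        (y i - h (x i)) ^ 2 + if i ∈ A then 2 * δ * (y i - h (x i)) + δ ^ 2 else 0 := by
      intro i
      simp only [hA, Finset.mem_filter, Finset.mem_univ, true_and]
      by_cases h3 : x i < t₀
      · simp [h3, not_le.2 h3]
      · by_cases h4 : a ≤ h (x i)
        · have : φ (h (x i)) = h (x i) - δ := by
            simp only [φ]
            rw [min_eq_right (by linarith), max_eq_left (by linarith)]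
          simp only [h3, if_false, this, not_lt.1 h3, h4, and_self, if_true]
          ring
        · have : φ (h (x i)) = h (x i) := by
            simp only [φ]
            rw [min_eq_left (hlt i (not_le.1 h4)), max_eq_right (by linarith)]
          simp [h3, h4, this]
    simp only [h2] at h1
    rw [Finset.sum_add_distrib, Finset.sum_ite_mem, Finset.univ_inter, Finset.sum_add_distrib,
      ← Finset.mul_sum, Finset.sum_const, nsmul_eq_mul] at h1
    by_contra hneg
    push Not at hneg
    nlinarith
  by_contra hneg
  push Not at hneg
  set S := ∑ i ∈ A, (y i - h (x i))
  have hc : (0 : ℝ) ≤ A.card := by positivity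
  -- If S < 0, this δ makes the quadratic term too small to compensate 2S.
  have h1 := key (min (a - a') (-S / (A.card + 1))) (lt_min (by linarith) (by
    apply div_pos <;> linarith)) (min_le_left _ _)
  have h2 : min (a - a') (-S / (A.card + 1)) * A.card ≤ -S := by
    calc _ ≤ -S / (A.card + 1) * A.card := by gcongr; exact min_le_right _ _
      _ ≤ -S / (A.card + 1) * (A.card + 1) := by
        have : 0 ≤ -S / ((A.card : ℝ) + 1) := by apply div_nonneg <;> linarith
        nlinarith
      _ = -S := by field_simp
  linarith

theorem IsIsotonicLSE.reflect {n : ℕ} {x y : Fin n → ℝ} {h : ℝ → ℝ} (hh : IsIsotonicLSE x y h) :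
    IsIsotonicLSE (fun i => 1 - x i) (fun i => -y i) (fun t => -h (1 - t)) := by
  have hI : ∀ t : ℝ, t ∈ Icc (0 : ℝ) 1 → 1 - t ∈ Icc (0 : ℝ) 1 := fun t ht =>
    ⟨by linarith [ht.2], by linarith [ht.1]⟩
  refine ⟨fun s hs t ht hst => neg_le_neg (hh.1 (hI t ht) (hI s hs) (by linarith)), ?_⟩
  intro ψ hψ
  have := hh.2 (fun t => -ψ (1 - t))
    (fun s hs t ht hst => neg_le_neg (hψ (hI t ht) (hI s hs) (by linarith)))
  convert this using 2 with i _ i _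
  · simp; ring
  · ring

theorem IsIsotonicLSE.sum_upper_sub_nonneg {n : ℕ} {x y : Fin n → ℝ} {h : ℝ → ℝ}
    (hh : IsIsotonicLSE x y h) (t₀ a : ℝ) :
    0 ≤ ∑ i ∈ Finset.univ.filter (fun i => t₀ ≤ x i ∧ a ≤ h (x i)), (y i - a) :=
  (hh.sum_upper_nonneg t₀ a).trans <| Finset.sum_le_sum fun i hi => by
    have := (Finset.mem_filter.1 hi).2.2
    linarith

/-- The reflected upper-level inequality is used at the largest fitted value below `a`, which turns
the open condition h < a into a closed one. Replacing the fitted values by `a` then loses strictly,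
because the set is nonempty. -/
theorem IsIsotonicLSE.sum_lower_sub_neg {n : ℕ} {x y : Fin n → ℝ} {h : ℝ → ℝ}
    (hh : IsIsotonicLSE x y h) (t₁ a : ℝ) (hne : ∃ i, x i ≤ t₁ ∧ h (x i) < a) :
    ∑ i ∈ Finset.univ.filter (fun i => x i ≤ t₁ ∧ h (x i) < a), (y i - a) < 0 := by
  obtain ⟨k, hk, hmax⟩ := Finset.exists_max_image
    (Finset.univ.filter fun i => h (x i) < a) (fun i => h (x i))
    (by obtain ⟨i, hi⟩ := hne; exact ⟨i, by simpa using hi.2⟩)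
  have h1 := hh.reflect.sum_upper_nonneg (1 - t₁) (-h (x k))
  have h2 : (Finset.univ.filter fun i => 1 - t₁ ≤ 1 - x i ∧ -h (x k) ≤ -h (1 - (1 - x i))) =
      Finset.univ.filter (fun i => x i ≤ t₁ ∧ h (x i) < a) := by
    ext i
    simp only [Finset.mem_filter, Finset.mem_univ, true_and, sub_sub_cancel, neg_le_neg_iff,
      sub_le_sub_iff_left]
    refine and_congr_right fun _ => ⟨fun h => h.trans_lt (by simpa using hk), fun h => ?_⟩
    exact hmax i (by simpa using h)
  rw [h2] at h1
  simp only [sub_sub_cancel] at h1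
  calc _ < ∑ i ∈ Finset.univ.filter (fun i => x i ≤ t₁ ∧ h (x i) < a), (y i - h (x i)) := by
        apply Finset.sum_lt_sum_of_nonempty
        · obtain ⟨i, hi⟩ := hne
          exact ⟨i, by simpa using hi⟩
        · intro i hi
          have := (Finset.mem_filter.1 hi).2.2
          linarith
    _ = -∑ i ∈ Finset.univ.filter (fun i => x i ≤ t₁ ∧ h (x i) < a), (-y i - -h (x i)) := by
        rw [← Finset.sum_neg_distrib]
        exact Finset.sum_congr rfl fun i _ => by ring
    _ ≤ 0 := by linarith

/-- A max-min description of the values of the least-squares estimator at design points. -/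
theorem IsIsotonicLSE.le_apply_iff {n : ℕ} {x y : Fin n → ℝ} {h : ℝ → ℝ}
    (hh : IsIsotonicLSE x y h) (hx : ∀ i, x i ∈ Icc (0 : ℝ) 1) (a : ℝ) (j : Fin n) :
    a ≤ h (x j) ↔ ∃ k, x j ≤ x k ∧ ∀ l, x l ≤ x j →
      0 ≤ ∑ i ∈ Finset.univ.filter (fun i => x l ≤ x i ∧ x i ≤ x k), (y i - a) := by
  constructor
  · intro hj
    -- The rightmost design point of the upper level set serves every `l` at once.
    obtain ⟨k, hk, hmax⟩ := Finset.exists_max_image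
      (Finset.univ.filter fun i => a ≤ h (x i)) x ⟨j, by simpa using hj⟩
    refine ⟨k, hmax j (by simpa using hj), fun l _ => ?_⟩
    convert hh.sum_upper_sub_nonneg (x l) a using 3 with i
    refine and_congr_right fun _ => ⟨fun h => ?_, fun h => hmax i (by simpa using h)⟩
    exact le_trans (by simpa using hk) (hh.1 (hx i) (hx k) h)
  · rintro ⟨k, hjk, hk⟩
    by_contra hj
    push Not at hj
    -- The leftmost design point of the lower level set contradicts the choice of `k`.
    obtain ⟨l, hl, hmin⟩ := Finset.exists_min_image
      (Finset.univ.filter fun i => h (x i) < a) x ⟨j, by simpa using hj⟩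
    have hlj := hmin j (by simpa using hj)
    have h1 := hk l hlj
    have h2 := hh.sum_lower_sub_neg (x k) a ⟨j, hjk, hj⟩
    have h3 : (Finset.univ.filter fun i => x l ≤ x i ∧ x i ≤ x k) =
        Finset.univ.filter (fun i => x i ≤ x k ∧ h (x i) < a) := by
      ext i
      simp only [Finset.mem_filter, Finset.mem_univ, true_and]
      rw [and_comm]
      refine and_congr_right fun _ => ⟨fun h => ?_, fun h => hmin i (by simpa using h)⟩
      exact (hh.1 (hx l) (hx i) h).trans_lt (by simpa using hl)
    rw [h3] at h1
    linarith

/-! ### Maximal inequality for the errors -/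

/-- A maximal inequality for sums of independent variables over the lower sets of a preorder given
by a real function `D` on the index set. -/
theorem pi_exists_lowerSet_sum_le (θ : ℝ) (hθ : 0 ≤ θ) : ∀ (n : ℕ) (D : Fin n → ℝ)
    (η : Fin n → Measure ℝ), (∀ i, IsProbabilityMeasure (η i)) →
    (∀ i, ∫⁻ y, ENNReal.ofReal (Real.exp (θ * y)) ∂η i ≤ 1) → ∀ b : ℝ,
    Measure.pi η {y | ∃ A : Finset (Fin n), (∀ i ∈ A, ∀ j, D j ≤ D i → j ∈ A) ∧
      b ≤ ∑ i ∈ A, y i} ≤ ENNReal.ofReal (Real.exp (-(θ * b))) := by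
  intro n
  induction n with
  | zero =>
    intro D η hη _ b
    by_cases hb : b ≤ 0
    · exact prob_le_one.trans (by
        rw [← ENNReal.ofReal_one]
        exact ENNReal.ofReal_le_ofReal (Real.one_le_exp (by nlinarith)))
    · have : {y : Fin 0 → ℝ | ∃ A : Finset (Fin 0), (∀ i ∈ A, ∀ j, D j ≤ D i → j ∈ A) ∧
          b ≤ ∑ i ∈ A, y i} = ∅ := by
        ext y
        simp [Finset.eq_empty_of_isEmpty, hb]
      rw [this, measure_empty]
      exact bot_le
  | succ n ih =>
    intro D η hη hmgf b
    by_cases hb : b ≤ 0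
    · exact prob_le_one.trans (by
        rw [← ENNReal.ofReal_one]
        exact ENNReal.ofReal_le_ofReal (Real.one_le_exp (by nlinarith)))
    -- For b > 0 the lower set is nonempty and so contains a minimal index. Integrating over that
    -- coordinate last leaves the same problem with b - y₀: Doob's inequality by induction.
    obtain ⟨i₀, _, hmin⟩ := Finset.exists_min_image Finset.univ D Finset.univ_nonempty
    set S : Set (ℝ × (Fin n → ℝ)) := {q | ∃ A : Finset (Fin n),
      (∀ i ∈ A, ∀ j, D (i₀.succAbove j) ≤ D (i₀.succAbove i) → j ∈ A) ∧
      b - q.1 ≤ ∑ i ∈ A, q.2 i} with hS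
    have hSm : MeasurableSet S := by
      have : S = ⋃ A : Finset (Fin n), {q | (∀ i ∈ A, ∀ j,
          D (i₀.succAbove j) ≤ D (i₀.succAbove i) → j ∈ A) ∧ b - q.1 ≤ ∑ i ∈ A, q.2 i} := by
        ext q; simp [hS]
      rw [this]
      refine MeasurableSet.iUnion fun A => MeasurableSet.inter (MeasurableSet.const _) ?_
      exact measurableSet_le (f := fun q : ℝ × (Fin n → ℝ) => b - q.1)
        (g := fun q => ∑ i ∈ A, q.2 i) (by fun_prop) (by fun_prop)
    have hmp := measurePreserving_piFinSuccAbove (fun i => η i) i₀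
    calc _ ≤ Measure.pi η (MeasurableEquiv.piFinSuccAbove (fun _ => ℝ) i₀ ⁻¹' S) := by
          apply measure_mono
          rintro y ⟨A, hA, hAb⟩
          have hne : A.Nonempty := by
            by_contra hne
            rw [Finset.not_nonempty_iff_eq_empty] at hne
            simp only [hne, Finset.sum_empty] at hAb
            exact hb hAb
          obtain ⟨i, hi⟩ := hne
          have hi₀ : i₀ ∈ A := hA i hi i₀ (hmin i (Finset.mem_univ _))
          refine ⟨Finset.univ.filter fun j => i₀.succAbove j ∈ A, ?_, ?_⟩
          · intro j hj k hk
            simp only [Finset.mem_filter, Finset.mem_univ, true_and] at hj ⊢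
            exact hA _ hj _ hk
          · have h1 : ∑ i ∈ A, y i = ∑ i, if i ∈ A then y i else 0 := by
              rw [Finset.sum_ite_mem, Finset.univ_inter]
            rw [h1, Fin.sum_univ_succAbove _ i₀, if_pos hi₀] at hAb
            rw [Finset.sum_filter]
            simp only [MeasurableEquiv.piFinSuccAbove_apply, Fin.insertNthEquiv_symm_apply,
              Fin.removeNth]
            linarith
      _ = ((η i₀).prod (Measure.pi fun j => η (i₀.succAbove j))) S :=
          hmp.measure_preimage hSm.nullMeasurableSet
      _ = ∫⁻ y₀, Measure.pi (fun j => η (i₀.succAbove j)) (Prod.mk y₀ ⁻¹' S) ∂η i₀ :=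
          Measure.prod_apply hSm
      _ ≤ ∫⁻ y₀, ENNReal.ofReal (Real.exp (-(θ * b))) * ENNReal.ofReal (Real.exp (θ * y₀)) ∂η i₀ := by
          refine lintegral_mono fun y₀ => ?_
          refine (ih (fun j => D (i₀.succAbove j)) (fun j => η (i₀.succAbove j))
            (fun _ => hη _) (fun _ => hmgf _) (b - y₀)).trans ?_
          rw [← ENNReal.ofReal_mul (Real.exp_nonneg _), ← Real.exp_add]
          exact (congrArg _ (congrArg _ (by ring))).le
      _ = ENNReal.ofReal (Real.exp (-(θ * b))) * ∫⁻ y₀, ENNReal.ofReal (Real.exp (θ * y₀)) ∂η i₀ :=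
          lintegral_const_mul _ (by fun_prop)
      _ ≤ _ := mul_le_of_le_one_right bot_le (hmgf i₀)

/-- A probability measure on the plane is the law of `(x, G x u)` with `x` and `u` independent and
`u` uniform. -/
theorem exists_map_prod_uniform_eq (ρ : Measure (ℝ × ℝ)) [IsProbabilityMeasure ρ] :
    ∃ G : ℝ → unitInterval → ℝ, Measurable (Function.uncurry G) ∧
      (ρ.fst.prod volume).map (fun q : ℝ × unitInterval => (q.1, G q.1 q.2)) = ρ := by
  obtain ⟨G, hG, hGκ⟩ := Kernel.exists_measurable_map_eq_unitInterval ρ.condKernel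
  have hG1 : ∀ x, Measurable (G x) := fun x => hG.comp measurable_prodMk_left
  have hG2 : Measurable (fun q : ℝ × unitInterval => (q.1, G q.1 q.2)) :=
    measurable_fst.prodMk hG
  refine ⟨G, hG, ?_⟩
  conv_rhs => rw [← ρ.disintegrate ρ.condKernel]
  ext s hs
  rw [Measure.map_apply hG2 hs, Measure.prod_apply (hG2 hs), Measure.compProd_apply hs]
  refine lintegral_congr fun x => ?_
  rw [← hGκ x, Measure.map_apply (hG1 x) (measurable_prodMk_left hs)]
  rfl

theorem lintegral_pi_prod_eq_pow {α : Type*} [MeasurableSpace α] (ρ : Measure α)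
    [IsProbabilityMeasure ρ] (n : ℕ) {g : α → ENNReal} (hg : Measurable g) :
    ∫⁻ w, ∏ i, g (w i) ∂Measure.pi (fun _ : Fin n => ρ) = (∫⁻ w, g w ∂ρ) ^ n := by
  have h := lintegral_prod_eq_prod_lintegral_of_indepFun (μ := Measure.pi (fun _ : Fin n => ρ))
    Finset.univ (fun i w => g (w i))
    (iIndepFun_pi (μ := fun _ : Fin n => ρ) (X := fun _ => g) fun i => hg.aemeasurable)
    (fun i => hg.comp (measurable_pi_apply i))
  rw [h]
  have : ∀ i : Fin n, ∫⁻ w, g (w i) ∂Measure.pi (fun _ : Fin n => ρ) = ∫⁻ w, g w ∂ρ := fun i =>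
    (measurePreserving_eval (fun _ : Fin n => ρ) i).lintegral_comp hg
  simp [this]

/-- Exponential bound for the partial sums, in the order prescribed by `D`, of the centred errors
of an independent sample. -/
theorem pi_exists_lowerSet_error_sum_le (ρ : Measure (ℝ × ℝ)) [IsProbabilityMeasure ρ]
    {m : ℝ → ℝ} (hm : Measurable m) {κ : ℝ} (θ : ℝ) (hθ : 0 ≤ θ)
    (hmgf : ∀ B : Set ℝ, MeasurableSet B →
      ∫⁻ w in Prod.fst ⁻¹' B, ENNReal.ofReal (Real.exp (θ * (w.2 - m w.1))) ∂ρ ≤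
        ENNReal.ofReal (Real.exp (κ * θ ^ 2)) * ρ (Prod.fst ⁻¹' B))
    (n : ℕ) {D β : ℝ → ℝ} (hD : Measurable D) (hβ : Measurable β) (β₀ : ℝ) :
    Measure.pi (fun _ : Fin n => ρ) {w | ∃ A : Finset (Fin n),
      (∀ i ∈ A, ∀ j, D (w j).1 ≤ D (w i).1 → j ∈ A) ∧
      β₀ + ∑ i, β (w i).1 ≤ ∑ i ∈ A, ((w i).2 - m (w i).1 - κ * θ)} ≤
    ENNReal.ofReal (Real.exp (-(θ * β₀))) *
      (∫⁻ w, ENNReal.ofReal (Real.exp (-(θ * β w.1))) ∂ρ) ^ n := by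
  -- Writing each response as a function of the design point and an independent uniform variable
  -- turns conditioning on the design into Fubini.
  obtain ⟨G, hG, hGρ⟩ := exists_map_prod_uniform_eq ρ
  have hG1 : ∀ x, Measurable (G x) := fun x => hG.comp measurable_prodMk_left
  have hG2 : Measurable (fun q : ℝ × unitInterval => (q.1, G q.1 q.2)) :=
    measurable_fst.prodMk hG
  set ν := ρ.fst with hν
  set E : Set (Fin n → ℝ × ℝ) := {w | ∃ A : Finset (Fin n),
      (∀ i ∈ A, ∀ j, D (w j).1 ≤ D (w i).1 → j ∈ A) ∧
      β₀ + ∑ i, β (w i).1 ≤ ∑ i ∈ A, ((w i).2 - m (w i).1 - κ * θ)} with hE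
  have hEm : MeasurableSet E := by
    have : E = ⋃ A : Finset (Fin n), (⋂ i ∈ A, ⋂ j, {w | D (w j).1 ≤ D (w i).1 → j ∈ A}) ∩
        {w | β₀ + ∑ i, β (w i).1 ≤ ∑ i ∈ A, ((w i).2 - m (w i).1 - κ * θ)} := by
      ext w; simp [hE]
    rw [this]
    refine MeasurableSet.iUnion fun A => MeasurableSet.inter ?_ ?_
    · refine MeasurableSet.biInter (Finset.countable_toSet A) fun i _ =>
        MeasurableSet.iInter fun j => ?_
      refine MeasurableSet.imp ?_ (MeasurableSet.const _)
      exact measurableSet_le (f := fun w : Fin n → ℝ × ℝ => D (w j).1)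
        (g := fun w => D (w i).1) (by fun_prop) (by fun_prop)
    · exact measurableSet_le (f := fun w : Fin n → ℝ × ℝ => β₀ + ∑ i, β (w i).1)
        (g := fun w => ∑ i ∈ A, ((w i).2 - m (w i).1 - κ * θ)) (by fun_prop) (by fun_prop)
  have hLm : Measurable fun q : ℝ × unitInterval =>
      ENNReal.ofReal (Real.exp (θ * (G q.1 q.2 - m q.1))) := by
    have : Measurable fun q : ℝ × unitInterval => G q.1 q.2 := hG
    fun_prop
  -- The bounds over all strips B × ℝ determine the conditional one for almost every x.
  have hL : ∀ᵐ x ∂ν, ∫⁻ u, ENNReal.ofReal (Real.exp (θ * (G x u - m x))) ≤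
      ENNReal.ofReal (Real.exp (κ * θ ^ 2)) := by
    refine ae_le_of_forall_setLIntegral_le_of_sigmaFinite hLm.lintegral_prod_right'
      fun B hB _ => ?_
    have h1 := hmgf B hB
    rw [← lintegral_indicator (measurable_fst hB)] at h1
    conv_lhs at h1 => rw [← hGρ]
    rw [lintegral_map (by
        refine Measurable.indicator ?_ (measurable_fst hB)
        fun_prop) hG2, lintegral_prod _ (by
        refine Measurable.aemeasurable ?_
        exact (Measurable.indicator (by fun_prop) (measurable_fst hB)).comp hG2)] at h1
    rw [setLIntegral_const, hν, Measure.fst_apply hB, ← lintegral_indicator hB]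
    refine le_trans (le_of_eq (lintegral_congr fun x => ?_)) h1
    by_cases hx : x ∈ B
    · simp [hx, indicator]
    · simp [hx, indicator]
  have hmap : (((Measure.pi fun _ : Fin n => ν).prod
      (Measure.pi fun _ : Fin n => (volume : Measure unitInterval))).map
      fun q i => (q.1 i, G (q.1 i) (q.2 i))) = Measure.pi (fun _ : Fin n => ρ) := by
    have h1 := (measurePreserving_arrowProdEquivProdArrow ℝ unitInterval (Fin n)
      (fun _ => ν) (fun _ => volume)).symm
    have h2 := measurePreserving_pi (fun _ : Fin n => ν.prod (volume : Measure unitInterval))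
      (fun _ : Fin n => ρ) (f := fun _ q => (q.1, G q.1 q.2)) (fun _ => ⟨hG2, hGρ⟩)
    exact (h2.comp h1).map_eq
  have hΦ : Measurable fun (q : (Fin n → ℝ) × (Fin n → unitInterval)) (i : Fin n) =>
      (q.1 i, G (q.1 i) (q.2 i)) :=
    measurable_pi_lambda _ fun i => hG2.comp (by fun_prop :
      Measurable fun q : (Fin n → ℝ) × (Fin n → unitInterval) => (q.1 i, q.2 i))
  rw [← hmap, Measure.map_apply hΦ hEm, Measure.prod_apply (hΦ hEm)]
  have hae : ∀ᵐ x ∂Measure.pi (fun _ : Fin n => ν), ∀ i,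
      ∫⁻ u, ENNReal.ofReal (Real.exp (θ * (G (x i) u - m (x i)))) ≤
      ENNReal.ofReal (Real.exp (κ * θ ^ 2)) :=
    ae_all_iff.2 fun i => (measurePreserving_eval (fun _ : Fin n => ν) i).quasiMeasurePreserving.ae hL
  calc _ ≤ ∫⁻ x, ENNReal.ofReal (Real.exp (-(θ * β₀))) *
          ∏ i, ENNReal.ofReal (Real.exp (-(θ * β (x i)))) ∂Measure.pi (fun _ : Fin n => ν) := by
        refine lintegral_mono_ae ?_
        filter_upwards [hae] with x hx
        have hξ : ∀ i, Measurable fun u : unitInterval => G (x i) u - m (x i) - κ * θ := fun i =>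
          ((hG1 (x i)).sub_const _).sub_const _
        set η : Fin n → Measure ℝ := fun i =>
          (volume : Measure unitInterval).map fun u => G (x i) u - m (x i) - κ * θ
        have hη : ∀ i, IsProbabilityMeasure (η i) := fun i =>
          Measure.isProbabilityMeasure_map (hξ i).aemeasurable
        have h1 := pi_exists_lowerSet_sum_le θ hθ n (fun i => D (x i)) η hη (fun i => by
          rw [lintegral_map (by fun_prop) (hξ i)]
          -- The compensator κθ is exactly what brings the exponential moment down to 1.
          have : ∀ u, ENNReal.ofReal (Real.exp (θ * (G (x i) u - m (x i) - κ * θ))) =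
              ENNReal.ofReal (Real.exp (-(κ * θ ^ 2))) *
                ENNReal.ofReal (Real.exp (θ * (G (x i) u - m (x i)))) := fun u => by
            rw [← ENNReal.ofReal_mul (Real.exp_nonneg _), ← Real.exp_add]
            congr 2; ring
          simp only [this]
          have hLx : Measurable fun u => ENNReal.ofReal (Real.exp (θ * (G (x i) u - m (x i)))) :=
            hLm.comp measurable_prodMk_left
          rw [lintegral_const_mul _ hLx]
          calc _ ≤ ENNReal.ofReal (Real.exp (-(κ * θ ^ 2))) *
                ENNReal.ofReal (Real.exp (κ * θ ^ 2)) := by gcongr; exact hx i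
            _ = 1 := by
              rw [← ENNReal.ofReal_mul (Real.exp_nonneg _), ← Real.exp_add]
              simp) (β₀ + ∑ i, β (x i))
        rw [← Measure.pi_map_pi (fun i => (hξ i).aemeasurable)] at h1
        refine (le_trans ?_ (Measure.le_map_apply
          (measurable_pi_lambda _ fun i => (hξ i).comp (measurable_pi_apply i)).aemeasurable _)).trans
          (h1.trans_eq ?_)
        · exact measure_mono fun u hu => hu
        · rw [← ENNReal.ofReal_prod_of_nonneg (fun _ _ => Real.exp_nonneg _), ← Real.exp_sum,
            ← ENNReal.ofReal_mul (Real.exp_nonneg _), ← Real.exp_add]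
          congr 2
          rw [mul_add, neg_add, Finset.mul_sum, Finset.sum_neg_distrib]
    _ = _ := by
        rw [lintegral_const_mul _ (by fun_prop), lintegral_pi_prod_eq_pow ν n
          (g := fun x => ENNReal.ofReal (Real.exp (-(θ * β x)))) (by fun_prop), hν, Measure.fst,
          lintegral_map (by fun_prop) measurable_fst]

/-! ### The regression model and its reflection -/

/-- `ρ` is the law of a pair `(X, Y)` with `X ∈ [0,1]`, a regression function `m` decreasing at a
speed between `A₁` and `A₂`, a density of `X` between `A₃` and `A₄`, and sub-Gaussian errors. -/
structure IsRegressionModel (A₁ A₂ A₃ A₄ κ : ℝ) (ρ : Measure (ℝ × ℝ)) (m : ℝ → ℝ) : Prop where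
  prob : IsProbabilityMeasure ρ
  ae_mem : ∀ᵐ w ∂ρ, w.1 ∈ Icc (0 : ℝ) 1
  interval_le : ∀ a b, 0 ≤ a → a ≤ b → b ≤ 1 → ρ.real (Prod.fst ⁻¹' Icc a b) ≤ A₄ * (b - a)
  le_interval : ∀ a b, 0 ≤ a → a ≤ b → b ≤ 1 → A₃ * (b - a) ≤ ρ.real (Prod.fst ⁻¹' Icc a b)
  meas : Measurable m
  le_sub : ∀ s t, 0 ≤ s → s ≤ t → t ≤ 1 → A₁ * (t - s) ≤ m s - m t
  sub_le : ∀ s t, 0 ≤ s → s ≤ t → t ≤ 1 → m s - m t ≤ A₂ * (t - s)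
  mgf : ∀ θ : ℝ, ∀ B : Set ℝ, MeasurableSet B →
      ∫⁻ w in Prod.fst ⁻¹' B, ENNReal.ofReal (Real.exp (θ * (w.2 - m w.1))) ∂ρ ≤
        ENNReal.ofReal (Real.exp (κ * θ ^ 2)) * ρ (Prod.fst ⁻¹' B)

/-- All constants survive, so a tail bound uniform over models applies to the reflected model as
well. The sign change of the errors uses the exponential bound at -θ. -/
theorem IsRegressionModel.reflect {A₁ A₂ A₃ A₄ κ : ℝ} {ρ : Measure (ℝ × ℝ)} {m : ℝ → ℝ}
    (hM : IsRegressionModel A₁ A₂ A₃ A₄ κ ρ m) :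
    IsRegressionModel A₁ A₂ A₃ A₄ κ (ρ.map fun w => (1 - w.1, -w.2)) (fun x => -m (1 - x)) := by
  have hf : Measurable fun w : ℝ × ℝ => (1 - w.1, -w.2) := by fun_prop
  have := hM.prob
  have hpre : ∀ a b : ℝ, (fun w : ℝ × ℝ => (1 - w.1, -w.2)) ⁻¹' (Prod.fst ⁻¹' Icc a b) =
      Prod.fst ⁻¹' Icc (1 - b) (1 - a) := by
    intro a b
    ext w
    simp only [mem_preimage, mem_Icc]
    constructor <;> rintro ⟨h1, h2⟩ <;> constructor <;> linarith
  have hreal : ∀ a b : ℝ, (ρ.map fun w => (1 - w.1, -w.2)).real (Prod.fst ⁻¹' Icc a b) =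
      ρ.real (Prod.fst ⁻¹' Icc (1 - b) (1 - a)) := fun a b => by
    rw [map_measureReal_apply hf (measurable_fst measurableSet_Icc), hpre]
  have hm := hM.meas
  refine ⟨Measure.isProbabilityMeasure_map hf.aemeasurable, ?_, ?_, ?_, by fun_prop, ?_, ?_, ?_⟩
  · rw [ae_map_iff hf.aemeasurable (measurable_fst measurableSet_Icc)]
    filter_upwards [hM.ae_mem] with w hw
    exact ⟨by linarith [hw.2], by linarith [hw.1]⟩
  · intro a b ha hab hb
    rw [hreal]
    have := hM.interval_le (1 - b) (1 - a) (by linarith) (by linarith) (by linarith)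
    linarith
  · intro a b ha hab hb
    rw [hreal]
    have := hM.le_interval (1 - b) (1 - a) (by linarith) (by linarith) (by linarith)
    linarith
  · intro s t hs hst ht
    have := hM.le_sub (1 - t) (1 - s) (by linarith) (by linarith) (by linarith)
    linarith
  · intro s t hs hst ht
    have := hM.sub_le (1 - t) (1 - s) (by linarith) (by linarith) (by linarith)
    linarith
  · intro θ B hB
    have h1 := hM.mgf (-θ) ((fun x => 1 - x) ⁻¹' B) ((by fun_prop : Measurable fun x : ℝ => 1 - x) hB)
    rw [setLIntegral_map (measurable_fst hB) (by fun_prop) hf, Measure.map_apply hf (measurable_fst hB)]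
    convert h1 using 1
    · refine lintegral_congr fun w => ?_
      congr 2
      simp
      ring
    · rw [neg_sq]; rfl

/-- `H w` is a least-squares estimator for the data `w`, with no values besides those at design
points, whenever the design points of `w` lie in `[0,1]`. -/
def IsLSEFamily {n : ℕ} (H : (Fin n → ℝ × ℝ) → ℝ → ℝ) : Prop :=
  ∀ w : Fin n → ℝ × ℝ, (∀ i, (w i).1 ∈ Icc (0 : ℝ) 1) →
    IsIsotonicLSE (fun i => (w i).1) (fun i => (w i).2) (H w) ∧
      ∀ t ∈ Icc (0 : ℝ) 1, ∃ i, H w t = H w (w i).1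

theorem IsLSEFamily.reflect {n : ℕ} {H : (Fin n → ℝ × ℝ) → ℝ → ℝ} (hH : IsLSEFamily H) :
    IsLSEFamily fun w t => -H (fun i => (1 - (w i).1, -(w i).2)) (1 - t) := by
  intro w hw
  obtain ⟨h1, h2⟩ := hH (fun i => (1 - (w i).1, -(w i).2))
    fun i => ⟨by linarith [(hw i).2], by linarith [(hw i).1]⟩
  refine ⟨?_, fun t ht => ?_⟩
  · simpa using h1.reflect
  · obtain ⟨i, hi⟩ := h2 (1 - t) ⟨by linarith [ht.2], by linarith [ht.1]⟩
    exact ⟨i, by simp [hi]⟩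

/-! ### Exceedance probabilities -/

namespace IsRegressionModel

variable {A₁ A₂ A₃ A₄ κ : ℝ} {ρ : Measure (ℝ × ℝ)} {m : ℝ → ℝ}

theorem ae_pi_mem (hM : IsRegressionModel A₁ A₂ A₃ A₄ κ ρ m) (n : ℕ) :
    ∀ᵐ w ∂Measure.pi (fun _ : Fin n => ρ), ∀ i, (w i).1 ∈ Icc (0 : ℝ) 1 := by
  have := hM.prob
  exact ae_all_iff.2 fun i =>
    (measurePreserving_eval (fun _ : Fin n => ρ) i).quasiMeasurePreserving.ae hM.ae_mem

/-- Master bound for the event that the estimator exceeds a level `a` at `t`. -/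
theorem pi_le_apply_le (hM : IsRegressionModel A₁ A₂ A₃ A₄ κ ρ m) {n : ℕ}
    {H : (Fin n → ℝ × ℝ) → ℝ → ℝ} (hH : IsLSEFamily H) {t₀ t a : ℝ} (ht₀ : 0 ≤ t₀) (htt : t₀ ≤ t)
    (ht : t ≤ 1) {θ : ℝ} (hθ : 0 ≤ θ) {β : ℝ → ℝ} (hβ : Measurable β) (β₀ : ℝ)
    (hdom : ∀ x : Fin n → ℝ, (∀ i, x i ∈ Icc (0 : ℝ) 1) → ∀ A : Finset (Fin n),
      (∀ i ∈ A, t₀ ≤ x i) → (∀ i, t₀ ≤ x i → x i ≤ t → i ∈ A) → (t₀ = 0 → A.Nonempty) →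
      β₀ + ∑ i, β (x i) ≤ ∑ i ∈ A, (a - m (x i) - κ * θ)) :
    Measure.pi (fun _ : Fin n => ρ) {w | a ≤ H w t} ≤
      ENNReal.ofReal (Real.exp (-(θ * β₀))) *
      (∫⁻ w, ENNReal.ofReal (Real.exp (-(θ * β w.1))) ∂ρ) ^ n := by
  have := hM.prob
  refine le_trans (measure_mono_ae ?_) (pi_exists_lowerSet_error_sum_le ρ hM.meas θ hθ (hM.mgf θ) n
    -- The value 2 exceeds every design point, so points left of `t₀` come last and the cut-off
    -- level set is an initial segment.
    (D := fun x => if t₀ ≤ x then x else 2) ?_ hβ β₀)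
  · filter_upwards [hM.ae_pi_mem n] with w hw ha
    obtain ⟨h1, h2⟩ := hH w hw
    have ha : a ≤ H w t := ha
    refine ⟨Finset.univ.filter fun i => t₀ ≤ (w i).1 ∧ a ≤ H w (w i).1, ?_, ?_⟩
    · intro i hi j hj
      simp only [Finset.mem_filter, Finset.mem_univ, true_and] at hi ⊢
      rw [if_pos hi.1] at hj
      split_ifs at hj with h
      · exact ⟨h, hi.2.trans (h1.1 (hw j) (hw i) hj)⟩
      · linarith [(hw i).2]
    · refine (hdom (fun i => (w i).1) hw
        (Finset.univ.filter fun i => t₀ ≤ (w i).1 ∧ a ≤ H w (w i).1)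
        (fun i hi => (Finset.mem_filter.1 hi).2.1) (fun i hi hit => ?_) (fun h0 => ?_)).trans ?_
      · simp only [Finset.mem_filter, Finset.mem_univ, true_and]
        exact ⟨hi, ha.trans (h1.1 (hw i) ⟨by linarith, ht⟩ hit)⟩
      -- With t₀ = 0 nothing is cut off, so the design point whose fitted value is taken at `t`
      -- belongs to the set.
      · obtain ⟨i, hi⟩ := h2 t ⟨by linarith, ht⟩
        refine ⟨i, ?_⟩
        simp only [Finset.mem_filter, Finset.mem_univ, true_and]
        exact ⟨h0 ▸ (hw i).1, hi ▸ ha⟩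
      · have h3 := h1.sum_upper_sub_nonneg t₀ a
        rw [← sub_nonneg, ← Finset.sum_sub_distrib]
        exact h3.trans_eq (Finset.sum_congr rfl fun i _ => by ring)
  · exact Measurable.ite measurableSet_Ici measurable_id measurable_const

theorem lintegral_two_step (hM : IsRegressionModel A₁ A₂ A₃ A₄ κ ρ m) {a b : ℝ} (ha : 0 ≤ a)
    (hb : b ≤ 1) {I J : Set ℝ} (hI : MeasurableSet I) (hJ : MeasurableSet J) :
    ∫⁻ w, ENNReal.ofReal (1 + I.indicator (fun _ => a) w.1 - J.indicator (fun _ => b) w.1) ∂ρ =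
      ENNReal.ofReal (1 + a * ρ.real (Prod.fst ⁻¹' I) - b * ρ.real (Prod.fst ⁻¹' J)) := by
  have := hM.prob
  have hi : ∀ (c : ℝ) (S : Set ℝ), MeasurableSet S →
      Integrable (fun w : ℝ × ℝ => S.indicator (fun _ => c) w.1) ρ := fun c S hS =>
    (integrable_const c).indicator (measurable_fst hS)
  have hv : ∀ (c : ℝ) (S : Set ℝ), MeasurableSet S →
      ∫ w : ℝ × ℝ, S.indicator (fun _ => c) w.1 ∂ρ = c * ρ.real (Prod.fst ⁻¹' S) := by
    intro c S hS
    have := integral_indicator_const (μ := ρ) c (measurable_fst hS : MeasurableSet (Prod.fst ⁻¹' S))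
    rw [smul_eq_mul, mul_comm] at this
    exact this
  rw [← ofReal_integral_eq_lintegral_ofReal]
  · have h1 : Integrable (fun w : ℝ × ℝ => 1 + I.indicator (fun _ => a) w.1) ρ :=
      (integrable_const _).add (hi a I hI)
    rw [integral_sub h1 (hi b J hJ),
      integral_add (integrable_const _) (hi a I hI), hv a I hI, hv b J hJ]
    simp
  · exact ((integrable_const _).add (hi a I hI)).sub (hi b J hJ)
  · refine Filter.Eventually.of_forall fun w => ?_
    simp only [indicator, Pi.zero_apply]
    split_ifs <;> linarith

theorem _root_.ENNReal.ofReal_pow_le_ofReal_exp {r k : ℝ} (h : r ≤ 1 - k) (n : ℕ) :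
    ENNReal.ofReal r ^ n ≤ ENNReal.ofReal (Real.exp (-(n * k))) := by
  have h1 : r ≤ Real.exp (-k) := h.trans (by linarith [Real.add_one_le_exp (-k)])
  calc _ ≤ ENNReal.ofReal (Real.exp (-k)) ^ n := by gcongr
    _ = _ := by
      rw [← ENNReal.ofReal_pow (Real.exp_nonneg _), ← Real.exp_nat_mul]
      congr 2; ring

theorem _root_.Real.half_le_one_sub_exp_neg {q : ℝ} (h0 : 0 ≤ q) (h1 : q ≤ 1) :
    q / 2 ≤ 1 - Real.exp (-q) := by
  have h2 : Real.exp (-q) * (1 + q) ≤ 1 := by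
    calc _ ≤ Real.exp (-q) * Real.exp q := by
          gcongr; linarith [Real.add_one_le_exp q]
      _ = 1 := by rw [← Real.exp_add]; simp
  have h3 := Real.exp_nonneg (-q)
  nlinarith

/-- Cubic-exponential bound for the event that the estimator still exceeds the level `a ≥ m t₀` at
distance `v` to the right of `t₀`. -/
theorem exists_pi_le_apply_add_le (hA₁ : 0 < A₁) (hA₃ : 0 < A₃) (hA₄ : 0 < A₄) (hκ : 0 < κ) :
    ∃ c : ℝ, 0 < c ∧ ∀ (ρ : Measure (ℝ × ℝ)) (m : ℝ → ℝ), IsRegressionModel A₁ A₂ A₃ A₄ κ ρ m →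
      ∀ (n : ℕ) (H : (Fin n → ℝ × ℝ) → ℝ → ℝ), IsLSEFamily H → ∀ t₀ v a : ℝ, 0 ≤ t₀ → 0 < v →
      t₀ + v ≤ 1 → m t₀ ≤ a →
      Measure.pi (fun _ : Fin n => ρ) {w | a ≤ H w (t₀ + v)} ≤
        ENNReal.ofReal (Real.exp (-(c * n * v ^ 3))) := by
  -- With θ = c v, the three conditions keep the compensator below half the drift on `J`, keep the
  -- exponent q below 1, and make the loss on `I` at most half the gain on `J`.
  obtain ⟨c, hc, hc1, hc2, hc3⟩ : ∃ c : ℝ, 0 < c ∧ κ * c ≤ A₁ / 4 ∧ c * A₁ ≤ 4 ∧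
      A₄ * κ * c ≤ A₃ * A₁ / 32 := by
    refine ⟨min (A₁ / (4 * κ)) (min (4 / A₁) (A₃ * A₁ / (32 * A₄ * κ))), by positivity, ?_, ?_, ?_⟩
    · calc _ ≤ κ * (A₁ / (4 * κ)) := by gcongr; exact min_le_left _ _
        _ = _ := by field_simp
    · calc _ ≤ 4 / A₁ * A₁ := by gcongr; exact (min_le_right _ _).trans (min_le_left _ _)
        _ = _ := by field_simp
    · calc _ ≤ A₄ * κ * (A₃ * A₁ / (32 * A₄ * κ)) := by
            gcongr; exact (min_le_right _ _).trans (min_le_right _ _)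
        _ = _ := by field_simp
  refine ⟨A₃ * A₁ * c / 32, by positivity, ?_⟩
  intro ρ m hM n H hH t₀ v a ht₀ hv htv ha
  have hv1 : v ≤ 1 := by linarith
  set θ := c * v with hθ
  have hθ0 : 0 < θ := by positivity
  have hκθ : κ * θ ≤ A₁ * v / 4 := by nlinarith
  set I := Icc t₀ (t₀ + v / 2) with hI
  set J := Icc (t₀ + v / 2) (t₀ + v) with hJ
  classical
  -- On `J` the drift is at least A₁v/2 and κθ takes at most half of it. On `I` only a nonnegative
  -- drift is available. Further right the drift still covers κθ, so zero suffices.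
  set β : ℝ → ℝ := fun x => if x ∈ J then A₁ * v / 4 else if x ∈ I then -(κ * θ) else 0 with hβ
  have hβm : Measurable β := Measurable.ite measurableSet_Icc measurable_const
    (Measurable.ite measurableSet_Icc measurable_const measurable_const)
  have h1 := hM.pi_le_apply_le (H := H) hH (t₀ := t₀) (t := t₀ + v) (a := a) ht₀ (by linarith) htv
    hθ0.le hβm 0 (by
      intro x hx A hA1 hA2 _
      rw [zero_add]
      -- `β` is supported in [t₀, t₀ + v], whose design points all belong to `A`.
      have hle : ∑ i, β (x i) ≤ ∑ i ∈ A, β (x i) := by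
        rw [← Finset.sum_subset (Finset.subset_univ (A ∪ Finset.univ.filter fun i => 0 < β (x i)))]
        · refine le_of_eq (congrArg (fun s => ∑ i ∈ s, β (x i)) ?_)
          rw [Finset.union_eq_left]
          intro i hi
          have hi : 0 < β (x i) := by simpa using hi
          simp only [hβ, hJ, hI, mem_Icc] at hi
          split_ifs at hi with h h'
          · exact hA2 i (by linarith) h.2
          · exact hA2 i h'.1 (by linarith)
          · exact absurd hi (lt_irrefl _)
        · intro i _ hi
          simp only [Finset.mem_union, Finset.mem_filter, Finset.mem_univ, true_and, not_or] at hi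
          have hi2 : ¬ (t₀ ≤ x i ∧ x i ≤ t₀ + v) := fun h => hi.1 (hA2 i h.1 h.2)
          simp only [hβ, hJ, hI, mem_Icc]
          rw [if_neg fun h => hi2 ⟨by linarith [h.1], h.2⟩,
            if_neg fun h => hi2 ⟨h.1, by linarith [h.2]⟩]
      refine hle.trans (Finset.sum_le_sum fun i hi => ?_)
      have h2 := hM.le_sub t₀ (x i) ht₀ (hA1 i hi) (hx i).2
      have h3 := hA1 i hi
      simp only [hβ, hJ, hI, mem_Icc]
      split_ifs with h h'
      · nlinarith [h.1]
      · nlinarith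
      · have : t₀ + v / 2 ≤ x i := by
          by_contra hlt
          exact h' ⟨h3, by linarith⟩
        nlinarith)
  refine h1.trans ?_
  rw [mul_zero, neg_zero, Real.exp_zero, ENNReal.ofReal_one, one_mul]
  set q := θ * (A₁ * v / 4) with hq
  have hq0 : 0 ≤ q := by positivity
  have hvv : v * v ≤ 1 := by nlinarith
  have hq1 : q ≤ 1 := by
    have : q = (c * A₁) * (v * v) / 4 := by rw [hq, hθ]; ring
    rw [this]
    nlinarith [mul_pos hc hA₁]
  have hκ0 : 0 ≤ κ * θ ^ 2 := by positivity
  have hκq : κ * θ ^ 2 ≤ q := by rw [hq]; nlinarith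
  have hexp : Real.exp (κ * θ ^ 2) - 1 ≤ 2 * (κ * θ ^ 2) := by
    have h2 := Real.abs_exp_sub_one_le (x := κ * θ ^ 2) (by rw [abs_of_nonneg hκ0]; linarith)
    rw [abs_of_nonneg hκ0] at h2
    exact (le_abs_self _).trans h2
  have hexp0 : 0 ≤ Real.exp (κ * θ ^ 2) - 1 := by
    linarith [Real.one_le_exp hκ0]
  have hexpq := Real.half_le_one_sub_exp_neg hq0 hq1
  have h2 : ∫⁻ w, ENNReal.ofReal (Real.exp (-(θ * β w.1))) ∂ρ ≤
      ENNReal.ofReal (1 + (Real.exp (κ * θ ^ 2) - 1) * ρ.real (Prod.fst ⁻¹' I) -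
        (1 - Real.exp (-q)) * ρ.real (Prod.fst ⁻¹' J)) := by
    rw [← hM.lintegral_two_step hexp0 (by linarith [Real.exp_nonneg (-q)])
      (measurableSet_Icc : MeasurableSet I) (measurableSet_Icc : MeasurableSet J)]
    refine lintegral_mono fun w => ENNReal.ofReal_le_ofReal ?_
    simp only [hβ, indicator]
    split_ifs
    · rw [← hq]; linarith
    · rw [← hq]; linarith
    · rw [show -(θ * -(κ * θ)) = κ * θ ^ 2 by ring]; linarith
    · simp
  have hp1 := hM.interval_le t₀ (t₀ + v / 2) ht₀ (by linarith) (by linarith)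
  have hp2 := hM.le_interval (t₀ + v / 2) (t₀ + v) (by linarith) (by linarith) htv
  have h3 : (1 + (Real.exp (κ * θ ^ 2) - 1) * ρ.real (Prod.fst ⁻¹' I) -
        (1 - Real.exp (-q)) * ρ.real (Prod.fst ⁻¹' J)) ≤ 1 - A₃ * A₁ * c / 32 * v ^ 3 := by
    have e1 : (Real.exp (κ * θ ^ 2) - 1) * ρ.real (Prod.fst ⁻¹' I) ≤
        2 * (κ * θ ^ 2) * (A₄ * (v / 2)) :=
      mul_le_mul hexp (hp1.trans_eq (by ring)) measureReal_nonneg (by positivity)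
    have e2 : q / 2 * (A₃ * (v / 2)) ≤ (1 - Real.exp (-q)) * ρ.real (Prod.fst ⁻¹' J) :=
      mul_le_mul hexpq (le_trans (le_of_eq (by ring)) hp2) (by positivity) (by linarith)
    have e3 : 2 * (κ * θ ^ 2) * (A₄ * (v / 2)) = (A₄ * κ * c) * (c * v ^ 3) := by rw [hθ]; ring
    have e4 : q / 2 * (A₃ * (v / 2)) = A₃ * A₁ * c * v ^ 3 / 16 := by rw [hq, hθ]; ring
    have e5 : (A₄ * κ * c) * (c * v ^ 3) ≤ A₃ * A₁ / 32 * (c * v ^ 3) := by gcongr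
    linarith
  calc _ ≤ ENNReal.ofReal _ ^ n := by gcongr
    _ ≤ _ := ENNReal.ofReal_pow_le_ofReal_exp h3 n
    _ = _ := by congr 2; ring

/-- Bound for the event that the estimator exceeds at `t` a level above all regression values. -/
theorem pi_le_apply_le_of_add_le (hM : IsRegressionModel A₁ A₂ A₃ A₄ κ ρ m) (hA₁ : 0 < A₁)
    (hκ : 0 < κ) {n : ℕ} {H : (Fin n → ℝ × ℝ) → ℝ → ℝ} (hH : IsLSEFamily H) {t z a : ℝ}
    (ht0 : 0 ≤ t) (ht1 : t ≤ 1) (hz : 0 < z) (ha : m 0 + z ≤ a) :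
    Measure.pi (fun _ : Fin n => ρ) {w | a ≤ H w t} ≤
      ENNReal.ofReal (Real.exp (-(z ^ 2 / (8 * κ)) -
        n * (A₃ * t * (1 - Real.exp (-(z ^ 2 / (8 * κ))))))) := by
  classical
  -- With this θ each summand keeps z/2 after compensation. One z/4 is counted over the design
  -- points in [0, t]; the other, from a single element of the nonempty set, gives the constant β₀ =
  -- z/4.
  set θ := z / (2 * κ) with hθ
  have hκθ : κ * θ = z / 2 := by rw [hθ]; field_simp
  have hq : θ * (z / 4) = z ^ 2 / (8 * κ) := by rw [hθ]; field_simp; norm_num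
  have hθ0 : 0 < θ := by positivity
  set q := z ^ 2 / (8 * κ) with hqd
  have hq0 : 0 ≤ q := by positivity
  set β : ℝ → ℝ := fun x => if x ∈ Icc 0 t then z / 4 else 0 with hβ
  have h1 := hM.pi_le_apply_le (H := H) hH (t₀ := 0) (t := t) (a := a) le_rfl ht0 ht1
    hθ0.le (β := β) (Measurable.ite measurableSet_Icc measurable_const measurable_const) (z / 4) (by
      intro x hx A hA1 hA2 hne
      have e1 : ∑ i, β (x i) ≤ ∑ i ∈ A, z / 4 := by
        have : ∑ i ∈ A, z / 4 = ∑ i, if i ∈ A then z / 4 else 0 := by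
          rw [Finset.sum_ite_mem, Finset.univ_inter]
        rw [this]
        refine Finset.sum_le_sum fun i _ => ?_
        simp only [hβ]
        split_ifs with h h'
        · exact le_rfl
        · exact absurd (hA2 i h.1 h.2) h'
        · linarith
        · exact le_rfl
      have e2 : z / 4 ≤ ∑ i ∈ A, z / 4 := by
        obtain ⟨i, hi⟩ := hne rfl
        exact Finset.single_le_sum (f := fun _ => z / 4) (fun _ _ => by positivity) hi
      have e3 : ∑ i ∈ A, z / 4 + ∑ i ∈ A, z / 4 ≤ ∑ i ∈ A, (a - m (x i) - κ * θ) := by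
        rw [← Finset.sum_add_distrib]
        refine Finset.sum_le_sum fun i hi => ?_
        have := hM.le_sub 0 (x i) le_rfl (hx i).1 (hx i).2
        rw [hκθ]
        nlinarith [(hx i).1]
      linarith)
  refine h1.trans ?_
  rw [hq]
  have h2 : ∫⁻ w, ENNReal.ofReal (Real.exp (-(θ * β w.1))) ∂ρ ≤
      ENNReal.ofReal (1 + 0 * ρ.real (Prod.fst ⁻¹' Icc 0 t) -
        (1 - Real.exp (-q)) * ρ.real (Prod.fst ⁻¹' Icc 0 t)) := by
    rw [← hM.lintegral_two_step le_rfl (by linarith [Real.exp_nonneg (-q)])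
      measurableSet_Icc measurableSet_Icc]
    refine lintegral_mono fun w => ENNReal.ofReal_le_ofReal ?_
    simp only [hβ, indicator]
    split_ifs
    · rw [hq]; linarith
    · simp
  have h3 : 1 + 0 * ρ.real (Prod.fst ⁻¹' Icc 0 t) -
        (1 - Real.exp (-q)) * ρ.real (Prod.fst ⁻¹' Icc 0 t) ≤
        1 - A₃ * t * (1 - Real.exp (-q)) := by
    have hp := hM.le_interval 0 t le_rfl ht0 ht1
    have : 0 ≤ 1 - Real.exp (-q) := by
      have := Real.exp_le_one_iff.2 (neg_nonpos.2 hq0)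
      linarith
    nlinarith
  calc _ ≤ ENNReal.ofReal (Real.exp (-q)) * ENNReal.ofReal _ ^ n := by gcongr
    _ ≤ ENNReal.ofReal (Real.exp (-q)) * ENNReal.ofReal _ := by
        gcongr
        exact ENNReal.ofReal_pow_le_ofReal_exp h3 n
    _ = _ := by
        rw [← ENNReal.ofReal_mul (Real.exp_nonneg _), ← Real.exp_add]
        rfl

end IsRegressionModel

/-! ### Moments from exponential tails -/

/-- Moment bound for a random variable with exponential tail. -/
theorem integrable_rpow_of_exp_tail {α : Type*} [MeasurableSpace α] {P : Measure α} {Z : α → ℝ}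
    (hZ : AEMeasurable Z P) (h0 : ∀ ω, 0 ≤ Z ω) {p C r : ℝ} (hp : 0 < p) (hC : 0 ≤ C) (hr : 0 < r)
    (htail : ∀ z, 0 < z → P {ω | z < Z ω} ≤ ENNReal.ofReal (C * Real.exp (-(r * z)))) :
    Integrable (fun ω => Z ω ^ p) P ∧
      ∫ ω, Z ω ^ p ∂P ≤ p * (C * ((1 / r) ^ p * Real.Gamma p)) := by
  have hΓ : 0 < (1 / r) ^ p * Real.Gamma p :=
    mul_pos (Real.rpow_pos_of_pos (by positivity) _) (Real.Gamma_pos_of_pos hp)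
  have hI := Real.integral_rpow_mul_exp_neg_mul_Ioi hp hr
  have hint : IntegrableOn (fun t : ℝ => t ^ (p - 1) * Real.exp (-(r * t))) (Ioi 0) := by
    -- A non-integrable function has integral 0 by convention, whereas the Gamma integral is
    -- positive.
    by_contra hn
    rw [integral_undef hn] at hI
    exact hΓ.ne hI
  have hmain : ∫⁻ ω, ENNReal.ofReal (Z ω ^ p) ∂P ≤
      ENNReal.ofReal (p * (C * ((1 / r) ^ p * Real.Gamma p))) := by
    rw [lintegral_rpow_eq_lintegral_meas_lt_mul P (Filter.Eventually.of_forall h0) hZ hp,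
      ENNReal.ofReal_mul hp.le]
    gcongr
    calc _ ≤ ∫⁻ t in Ioi (0 : ℝ),
          ENNReal.ofReal (C * (t ^ (p - 1) * Real.exp (-(r * t)))) := by
          refine setLIntegral_mono (by fun_prop) fun t ht => ?_
          calc _ ≤ ENNReal.ofReal (C * Real.exp (-(r * t))) * ENNReal.ofReal (t ^ (p - 1)) := by
                gcongr; exact htail t ht
            _ = _ := by
                rw [← ENNReal.ofReal_mul (by positivity)]
                congr 1; ring
      _ = ENNReal.ofReal (C * ((1 / r) ^ p * Real.Gamma p)) := by
          rw [← ofReal_integral_eq_lintegral_ofReal (hint.const_mul C), integral_const_mul, hI]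
          rw [Filter.EventuallyLE, ae_restrict_iff' measurableSet_Ioi]
          refine Filter.Eventually.of_forall fun t ht => ?_
          have : (0 : ℝ) < t := ht
          simp only [Pi.zero_apply]
          positivity
  have hm : AEStronglyMeasurable (fun ω => Z ω ^ p) P := (hZ.pow_const p).aestronglyMeasurable
  have hnn : ∀ ω, 0 ≤ Z ω ^ p := fun ω => Real.rpow_nonneg (h0 ω) p
  refine ⟨⟨hm, ?_⟩, ?_⟩
  · rw [hasFiniteIntegral_iff_ofReal (Filter.Eventually.of_forall hnn)]
    exact hmain.trans_lt ENNReal.ofReal_lt_top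
  · rw [integral_eq_lintegral_of_nonneg_ae (Filter.Eventually.of_forall hnn) hm]
    exact ENNReal.toReal_le_of_le_ofReal (by positivity) hmain

/-! ### Generalized inverse -/

theorem genInv_mem {h : ℝ → ℝ} {a : ℝ} : genInv h a ∈ Icc (0 : ℝ) 1 :=
  ⟨Real.sSup_nonneg fun _ ht => ht.1.1, Real.sSup_le (fun _ ht => ht.1.2) zero_le_one⟩

theorem le_genInv {h : ℝ → ℝ} {a t : ℝ} (ht : t ∈ Icc (0 : ℝ) 1) (hta : a ≤ h t) :
    t ≤ genInv h a :=
  le_csSup ⟨1, fun _ hs => hs.1.2⟩ ⟨ht, hta⟩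

theorem exists_of_lt_genInv {h : ℝ → ℝ} {a s : ℝ} (hs : 0 ≤ s) (hsa : s < genInv h a) :
    ∃ t ∈ Icc (0 : ℝ) 1, s < t ∧ a ≤ h t := by
  have hne : {t | t ∈ Icc (0 : ℝ) 1 ∧ a ≤ h t}.Nonempty := by
    by_contra hne
    rw [genInv, not_nonempty_iff_eq_empty.1 hne, Real.sSup_empty] at hsa
    linarith
  obtain ⟨t, ht, hst⟩ := exists_lt_of_lt_csSup hne hsa
  exact ⟨t, ht.1, hst, ht.2⟩

theorem le_of_lt_genInv {h : ℝ → ℝ} (hh : AntitoneOn h (Icc 0 1)) {a s : ℝ} (hs : 0 ≤ s)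
    (hsa : s < genInv h a) : a ≤ h s := by
  obtain ⟨t, ht, hst, hta⟩ := exists_of_lt_genInv hs hsa
  exact hta.trans (hh ⟨hs, hst.le.trans ht.2⟩ ht hst.le)

/-! ### Measurability of the estimator and its inverse -/

/-- The isotonic least-squares estimator as a function of the data. -/
noncomputable def lseOfData {n : ℕ} (w : Fin n → ℝ × ℝ) : ℝ → ℝ :=
  isotonicLSE (fun i => (w i).1) (fun i => (w i).2)

theorem lseOfData_spec {n : ℕ} {w : Fin n → ℝ × ℝ} (hw : ∀ i, (w i).1 ∈ Icc (0 : ℝ) 1) :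
    IsIsotonicLSE (fun i => (w i).1) (fun i => (w i).2) (lseOfData w) ∧
      IsDesignStep (fun i => (w i).1) (lseOfData w) := by
  have H := exists_isotonicLSE (fun i => (w i).1) (fun i => (w i).2) hw
  rw [lseOfData, isotonicLSE, dif_pos H]
  exact H.choose_spec

theorem lseOfData_eq {n : ℕ} {w : Fin n → ℝ × ℝ} (hw : ∀ i, (w i).1 ∈ Icc (0 : ℝ) 1) {t : ℝ}
    (ht : t ∈ Icc (0 : ℝ) 1) {i : Fin n}
    (hi : (t ≤ (w i).1 ∧ ∀ j, t ≤ (w j).1 → (w i).1 ≤ (w j).1) ∨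
      ((∀ j, (w j).1 < t) ∧ ∀ j, (w j).1 ≤ (w i).1)) :
    lseOfData w t = lseOfData w (w i).1 := by
  obtain ⟨h1, h2⟩ := (lseOfData_spec hw).2
  rcases hi with ⟨a, b⟩ | ⟨a, b⟩
  · exact h1 i t ht a fun j hj => by
      by_contra hlt
      have := b j (not_lt.1 hlt)
      linarith
  · exact h2 i t ht (a i).le b

theorem isLSEFamily_lseOfData {n : ℕ} (hn : 1 ≤ n) :
    IsLSEFamily (lseOfData : (Fin n → ℝ × ℝ) → ℝ → ℝ) := fun w hw =>
  ⟨(lseOfData_spec hw).1, fun t ht => by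
    obtain ⟨i, hi⟩ := exists_design_index hn (fun i => (w i).1) t
    exact ⟨i, lseOfData_eq hw ht hi⟩⟩

theorem measurableSet_good (n : ℕ) :
    MeasurableSet {w : Fin n → ℝ × ℝ | ∀ i, (w i).1 ∈ Icc (0 : ℝ) 1} := by
  rw [ofPred_forall]
  exact MeasurableSet.iInter fun i =>
    (by fun_prop : Measurable fun w : Fin n → ℝ × ℝ => (w i).1) measurableSet_Icc

/-- The estimator is obtained by choice, so measurability rests on the max-min description: `t` is
replaced by the design point carrying its value, and the event becomes a finite combination of
inequalities between measurable functions. -/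
theorem measurableSet_le_lseOfData {n : ℕ} (hn : 1 ≤ n) {t : ℝ} (ht : t ∈ Icc (0 : ℝ) 1) (a : ℝ) :
    MeasurableSet {w : Fin n → ℝ × ℝ | (∀ i, (w i).1 ∈ Icc (0 : ℝ) 1) ∧ a ≤ lseOfData w t} := by
  classical
  have hx : ∀ i : Fin n, Measurable fun w : Fin n → ℝ × ℝ => (w i).1 := fun i => by fun_prop
  have heq : {w : Fin n → ℝ × ℝ | (∀ i, (w i).1 ∈ Icc (0 : ℝ) 1) ∧ a ≤ lseOfData w t} =
      {w | ∀ i, (w i).1 ∈ Icc (0 : ℝ) 1} ∩ ⋃ j, ({w | (t ≤ (w j).1 ∧ ∀ k, t ≤ (w k).1 →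
        (w j).1 ≤ (w k).1) ∨ ((∀ k, (w k).1 < t) ∧ ∀ k, (w k).1 ≤ (w j).1)} ∩
        {w | ∃ k, (w j).1 ≤ (w k).1 ∧ ∀ l, (w l).1 ≤ (w j).1 →
          0 ≤ ∑ i, if (w l).1 ≤ (w i).1 ∧ (w i).1 ≤ (w k).1 then (w i).2 - a else 0}) := by
    ext w
    simp only [mem_inter_iff, mem_iUnion, mem_ofPred_eq]
    refine and_congr_right fun hw => ?_
    have key := fun j => (lseOfData_spec hw).1.le_apply_iff hw a j
    simp only [Finset.sum_filter] at key
    constructor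
    · intro h
      obtain ⟨i, hi⟩ := exists_design_index hn (fun i => (w i).1) t
      refine ⟨i, hi, (key i).1 ?_⟩
      rwa [← lseOfData_eq hw ht hi]
    · rintro ⟨i, hi, h⟩
      rw [lseOfData_eq hw ht hi]
      exact (key i).2 h
  rw [heq]
  have hall : ∀ p : Fin n → (Fin n → ℝ × ℝ) → Prop, (∀ i, MeasurableSet {w | p i w}) →
      MeasurableSet {w | ∀ i, p i w} := fun p hp => by
    rw [ofPred_forall]; exact MeasurableSet.iInter hp
  have hex : ∀ p : Fin n → (Fin n → ℝ × ℝ) → Prop, (∀ i, MeasurableSet {w | p i w}) →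
      MeasurableSet {w | ∃ i, p i w} := fun p hp => by
    rw [ofPred_exists]; exact MeasurableSet.iUnion hp
  have hand : ∀ p q : (Fin n → ℝ × ℝ) → Prop, MeasurableSet {w | p w} → MeasurableSet {w | q w} →
      MeasurableSet {w | p w ∧ q w} := fun p q hp hq => hp.inter hq
  have hor : ∀ p q : (Fin n → ℝ × ℝ) → Prop, MeasurableSet {w | p w} → MeasurableSet {w | q w} →
      MeasurableSet {w | p w ∨ q w} := fun p q hp hq => hp.union hq
  refine (measurableSet_good n).inter (MeasurableSet.iUnion fun j => MeasurableSet.inter ?_ ?_)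
  · refine hor _ _ (hand _ _ ?_ (hall _ fun k => ?_)) (hand _ _ (hall _ fun k => ?_)
      (hall _ fun k => ?_))
    · exact measurableSet_le measurable_const (hx j)
    · exact (measurableSet_le measurable_const (hx k)).imp (measurableSet_le (hx j) (hx k))
    · exact measurableSet_lt (hx k) measurable_const
    · exact measurableSet_le (hx k) (hx j)
  · refine hex _ fun k => hand _ _ (measurableSet_le (hx j) (hx k)) (hall _ fun l =>
      (measurableSet_le (hx l) (hx j)).imp ?_)
    refine measurableSet_le measurable_const (Finset.measurable_sum _ fun i _ => ?_)
    exact Measurable.ite (hand _ _ (measurableSet_le (hx l) (hx i))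
      (measurableSet_le (hx i) (hx k))) (by fun_prop) measurable_const

theorem aemeasurable_lseOfData {n : ℕ} (hn : 1 ≤ n) {t : ℝ} (ht : t ∈ Icc (0 : ℝ) 1)
    {Q : Measure (Fin n → ℝ × ℝ)} (hQ : ∀ᵐ w ∂Q, ∀ i, (w i).1 ∈ Icc (0 : ℝ) 1) :
    AEMeasurable (fun w => lseOfData w t) Q := by
  classical
  refine ⟨fun w => if ∀ i, (w i).1 ∈ Icc (0 : ℝ) 1 then lseOfData w t else 0, ?_, ?_⟩
  · refine measurable_of_Ici fun a => ?_
    have : (fun w : Fin n → ℝ × ℝ =>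
        if ∀ i, (w i).1 ∈ Icc (0 : ℝ) 1 then lseOfData w t else 0) ⁻¹' Ici a =
        {w | (∀ i, (w i).1 ∈ Icc (0 : ℝ) 1) ∧ a ≤ lseOfData w t} ∪
        ({w | ∀ i, (w i).1 ∈ Icc (0 : ℝ) 1}ᶜ ∩ {_w | a ≤ 0}) := by
      ext w
      simp only [mem_preimage, mem_Ici, mem_union, mem_ofPred_eq, mem_inter_iff, mem_compl_iff]
      split_ifs with h <;> tauto
    rw [this]
    exact (measurableSet_le_lseOfData hn ht a).union
      ((measurableSet_good n).compl.inter (MeasurableSet.const _))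
  · filter_upwards [hQ] with w hw
    rw [if_pos hw]

theorem aemeasurable_genInv_lseOfData {n : ℕ} (hn : 1 ≤ n) (a : ℝ)
    {Q : Measure (Fin n → ℝ × ℝ)} (hQ : ∀ᵐ w ∂Q, ∀ i, (w i).1 ∈ Icc (0 : ℝ) 1) :
    AEMeasurable (fun w => genInv (lseOfData w) a) Q := by
  classical
  refine ⟨fun w => if ∀ i, (w i).1 ∈ Icc (0 : ℝ) 1 then genInv (lseOfData w) a else 0, ?_, ?_⟩
  · refine measurable_of_Ioi fun s => ?_
    rcases lt_or_ge s 0 with hs | hs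
    · convert MeasurableSet.univ
      ext w
      simp only [mem_preimage, mem_Ioi, mem_univ, iff_true]
      split_ifs
      · exact hs.trans_le genInv_mem.1
      · exact hs
    · have : (fun w : Fin n → ℝ × ℝ =>
          if ∀ i, (w i).1 ∈ Icc (0 : ℝ) 1 then genInv (lseOfData w) a else 0) ⁻¹' Ioi s =
          -- Monotonicity lets a rational point between `s` and a witness replace the witness.
          ⋃ q : ℚ, ⋃ (_ : s < q ∧ (q : ℝ) ∈ Icc (0 : ℝ) 1),
            {w | (∀ i, (w i).1 ∈ Icc (0 : ℝ) 1) ∧ a ≤ lseOfData w q} := by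
        ext w
        simp only [mem_preimage, mem_Ioi, mem_iUnion, mem_ofPred_eq, exists_prop]
        split_ifs with h
        · constructor
          · intro hlt
            obtain ⟨t, ht, hst, hta⟩ := exists_of_lt_genInv hs hlt
            obtain ⟨q, hsq, hqt⟩ := exists_rat_btwn hst
            have hq : (q : ℝ) ∈ Icc (0 : ℝ) 1 := ⟨by linarith, by linarith [ht.2]⟩
            exact ⟨q, ⟨hsq, hq⟩, h, hta.trans ((lseOfData_spec h).1.1 hq ht hqt.le)⟩
          · rintro ⟨q, ⟨hsq, hq⟩, _, hqa⟩
            exact hsq.trans_le (le_genInv hq hqa)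
        · constructor
          · intro h0
            linarith
          · rintro ⟨_, _, h', _⟩
            exact absurd h' h
      rw [this]
      exact MeasurableSet.iUnion fun q => MeasurableSet.iUnion fun hq =>
        measurableSet_le_lseOfData hn hq.2 a
  · filter_upwards [hQ] with w hw
    rw [if_pos hw]

/-! ### Tails at the scale n^(-1/3) -/

/-- Transfers lower deviations to upper ones for the reflected sample. An inequality suffices, so
the events need not be measurable; 1 - (1 - t) stays unsimplified to match `IsLSEFamily.reflect` at
1 - t. -/
theorem pi_apply_le_le_reflect (ρ : Measure (ℝ × ℝ)) [IsProbabilityMeasure ρ] {n : ℕ}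
    (H : (Fin n → ℝ × ℝ) → ℝ → ℝ) (t b : ℝ) :
    Measure.pi (fun _ : Fin n => ρ) {w | H w t ≤ b} ≤
      Measure.pi (fun _ : Fin n => ρ.map fun w => (1 - w.1, -w.2))
        {w | -b ≤ -H (fun i => (1 - (w i).1, -(w i).2)) (1 - (1 - t))} := by
  have hf : Measurable fun w : ℝ × ℝ => (1 - w.1, -w.2) := by fun_prop
  have : IsProbabilityMeasure (ρ.map fun w => (1 - w.1, -w.2)) :=
    Measure.isProbabilityMeasure_map hf.aemeasurable
  rw [← Measure.pi_map_pi (fun _ : Fin n => hf.aemeasurable)]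
  refine le_trans (measure_mono fun w hw => ?_) (Measure.le_map_apply
    (measurable_pi_lambda _ fun i => hf.comp (measurable_pi_apply i)).aemeasurable _)
  simpa using hw

namespace IsRegressionModel

variable {A₁ A₂ A₃ A₄ κ : ℝ} {ρ : Measure (ℝ × ℝ)} {m : ℝ → ℝ}

/-- Exponential upper tail of the pointwise error at scale `n^(-1/3)`. -/
theorem exists_pi_add_le_apply_le (hA₁ : 0 < A₁) (hA₂ : 0 < A₂) (hA₃ : 0 < A₃) (hA₄ : 0 < A₄)
    (hκ : 0 < κ) :
    ∃ c : ℝ, 0 < c ∧ ∀ (ρ : Measure (ℝ × ℝ)) (m : ℝ → ℝ), IsRegressionModel A₁ A₂ A₃ A₄ κ ρ m →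
      ∀ (n : ℕ) (H : (Fin n → ℝ × ℝ) → ℝ → ℝ), IsLSEFamily H → ∀ y t z : ℝ, 0 < y → y ^ 3 = n →
      1 / y ≤ t → t ≤ 1 → 0 < z →
      Measure.pi (fun _ : Fin n => ρ) {w | m t + z ≤ H w t} ≤
        ENNReal.ofReal (Real.exp (1 - c * y * z)) := by
  obtain ⟨c₁, hc₁, hT⟩ := exists_pi_le_apply_add_le (A₂ := A₂) hA₁ hA₃ hA₄ hκ
  set k₁ := c₁ / (8 * A₂ ^ 3) with hk₁
  set k₂ := A₃ / (64 * κ) with hk₂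
  have hk₁0 : 0 < k₁ := by positivity
  have hk₂0 : 0 < k₂ := by positivity
  -- The first minimum weakens the cubic exponent to a linear one, up to the additive 1; 2√k₂ is the
  -- AM-GM constant of the large-deviation case.
  refine ⟨min (min k₁ 1) (2 * √k₂), by positivity, ?_⟩
  intro ρ m hM n H hH y t z hy hyn hyt ht1 hz
  set c := min (min k₁ 1) (2 * √k₂)
  have hcw : ∀ w, 0 ≤ w → c * w ≤ k₁ * w ^ 3 + 1 := by
    intro w hw
    have h1 : c ≤ k₁ := (min_le_left _ _).trans (min_le_left _ _)
    have h2 : c ≤ 1 := (min_le_left _ _).trans (min_le_right _ _)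
    have h3 : 0 < c := by positivity
    rcases le_total w 1 with h | h
    · have : 0 ≤ k₁ * w ^ 3 := by positivity
      nlinarith
    · have h5 : w ≤ w ^ 3 := le_self_pow₀ h (by norm_num)
      calc c * w ≤ k₁ * w ^ 3 := by gcongr
        _ ≤ _ := by linarith
  have hcs : ∀ w, 0 ≤ w → c * w ≤ 2 * √k₂ * w := fun w hw => by
    gcongr; exact min_le_right _ _
  have hyz : 0 < y * z := by positivity
  have ht0 : 0 < t := lt_of_lt_of_le (by positivity) hyt
  rcases le_total z (2 * A₂ * t) with hzt | hzt
  -- Moving left by z/(2A₂) raises the regression function by at most z/2, so the level still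
  -- dominates it at the cut-off.
  · have hv : 0 < z / (2 * A₂) := by positivity
    have hvt : z / (2 * A₂) ≤ t := by
      rw [div_le_iff₀ (by positivity)]; linarith
    have h1 := hT ρ m hM n H hH (t - z / (2 * A₂)) (z / (2 * A₂)) (m t + z) (by linarith) hv
      (by linarith) (by
        have := hM.sub_le (t - z / (2 * A₂)) t (by linarith) (by linarith) ht1
        have h2 : A₂ * (t - (t - z / (2 * A₂))) = z / 2 := by field_simp; ring
        linarith)
    rw [sub_add_cancel] at h1
    refine h1.trans (ENNReal.ofReal_le_ofReal (Real.exp_le_exp.2 ?_))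
    have h2 := hcw (y * z) hyz.le
    have h3 : c₁ * n * (z / (2 * A₂)) ^ 3 = k₁ * (y * z) ^ 3 := by
      rw [hk₁, ← hyn]; field_simp; ring
    rw [h3]
    linarith
  -- Here μ(0) ≤ μ(t) + A₂t ≤ μ(t) + z/2, so the level lies z/2 above the maximum of μ.
  · have h1 := hM.pi_le_apply_le_of_add_le hA₁ hκ hH ht0.le ht1 (z := z / 2) (a := m t + z)
      (by positivity) (by
        have := hM.sub_le 0 t le_rfl ht0.le ht1
        linarith)
    refine h1.trans (ENNReal.ofReal_le_ofReal (Real.exp_le_exp.2 ?_))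
    set q := (z / 2) ^ 2 / (8 * κ) with hq
    have hq0 : 0 < q := by positivity
    -- The distance of `t` from the end point 0 enters here: about y² design points are expected to
    -- its left.
    have hnt : y ^ 2 ≤ n * t := by
      rw [← hyn]
      calc y ^ 2 = y ^ 3 * (1 / y) := by field_simp
        _ ≤ _ := by gcongr
    have hqk : A₃ * q / 2 = k₂ * z ^ 2 := by
      rw [hq, hk₂]; field_simp; norm_num
    have hs : √k₂ ^ 2 = k₂ := Real.sq_sqrt hk₂0.le
    have hcyz := hcs (y * z) hyz.le
    have hE : 0 ≤ 1 - Real.exp (-q) := by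
      have := Real.exp_le_one_iff.2 (neg_nonpos.2 hq0.le)
      linarith
    have hB : A₃ * y ^ 2 * (1 - Real.exp (-q)) ≤ n * (A₃ * t * (1 - Real.exp (-q))) := by
      calc _ ≤ A₃ * (n * t) * (1 - Real.exp (-q)) := by gcongr
        _ = _ := by ring
    rcases le_total q 1 with hq1 | hq1
    · have h2 := Real.half_le_one_sub_exp_neg hq0.le hq1
      have h3 : A₃ * y ^ 2 * (q / 2) ≤ A₃ * y ^ 2 * (1 - Real.exp (-q)) := by gcongr
      have h4 : A₃ * y ^ 2 * (q / 2) = (√k₂ * (y * z)) ^ 2 := by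
        rw [mul_pow, hs]
        linear_combination y ^ 2 * hqk
      nlinarith [sq_nonneg (√k₂ * (y * z) - 1)]
    · have h2 : 1 / 2 ≤ 1 - Real.exp (-q) := by
        have h5 := Real.half_le_one_sub_exp_neg zero_le_one le_rfl
        have h6 : Real.exp (-q) ≤ Real.exp (-1) := Real.exp_le_exp.2 (by linarith)
        linarith
      have h3 : A₃ * y ^ 2 * (1 / 2) ≤ A₃ * y ^ 2 * (1 - Real.exp (-q)) := by gcongr
      have h4 : (2 * √k₂ * (y * z)) ^ 2 ≤ (q + A₃ * y ^ 2 * (1 / 2)) ^ 2 := by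
        have : (2 * √k₂ * (y * z)) ^ 2 = 4 * q * (A₃ * y ^ 2 * (1 / 2)) := by
          rw [mul_pow, mul_pow, hs]
          linear_combination -4 * y ^ 2 * hqk
        rw [this]
        nlinarith [sq_nonneg (q - A₃ * y ^ 2 * (1 / 2))]
      have h5 := abs_le_of_sq_le_sq' h4 (by positivity)
      linarith [h5.2]

/-- Exponential tail of the pointwise error at scale `n^(-1/3)`. -/
theorem exists_pi_lt_abs_apply_sub_le (hA₁ : 0 < A₁) (hA₂ : 0 < A₂) (hA₃ : 0 < A₃) (hA₄ : 0 < A₄)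
    (hκ : 0 < κ) :
    ∃ c : ℝ, 0 < c ∧ ∀ (ρ : Measure (ℝ × ℝ)) (m : ℝ → ℝ), IsRegressionModel A₁ A₂ A₃ A₄ κ ρ m →
      ∀ (n : ℕ) (H : (Fin n → ℝ × ℝ) → ℝ → ℝ), IsLSEFamily H → ∀ y t z : ℝ, 0 < y → y ^ 3 = n →
      1 / y ≤ t → t ≤ 1 - 1 / y → 0 < z →
      Measure.pi (fun _ : Fin n => ρ) {w | z < |H w t - m t|} ≤
        ENNReal.ofReal (2 * Real.exp 1 * Real.exp (-(c * y * z))) := by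
  obtain ⟨c, hc, hT⟩ := exists_pi_add_le_apply_le hA₁ hA₂ hA₃ hA₄ hκ
  refine ⟨c, hc, fun ρ m hM n H hH y t z hy hyn hyt hyt' hz => ?_⟩
  have := hM.prob
  have hy1 : 0 < 1 / y := by positivity
  have h1 := hT ρ m hM n H hH y t z hy hyn hyt (by linarith) hz
  have h2 := (pi_apply_le_le_reflect ρ H t (m t - z)).trans <| (measure_mono fun w hw => ?_).trans
    (hT _ _ hM.reflect n _ hH.reflect y (1 - t) z hy hyn (by linarith) (by linarith) hz)
  · calc _ ≤ Measure.pi (fun _ : Fin n => ρ) ({w | m t + z ≤ H w t} ∪ {w | H w t ≤ m t - z}) := by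
          refine measure_mono fun w hw => ?_
          rcases lt_abs.1 (show z < |H w t - m t| from hw) with h | h
          · left; simp only [mem_ofPred_eq]; linarith
          · right; simp only [mem_ofPred_eq]; linarith
      _ ≤ ENNReal.ofReal (Real.exp (1 - c * y * z)) + ENNReal.ofReal (Real.exp (1 - c * y * z)) :=
          (measure_union_le _ _).trans (add_le_add h1 h2)
      _ = _ := by
          rw [← ENNReal.ofReal_add (by positivity) (by positivity), mul_assoc 2, ← Real.exp_add,
            ← two_mul, sub_eq_add_neg]
  · simp only [mem_ofPred_eq, sub_sub_cancel] at hw ⊢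
    linarith

/-- Exponential tail of the error of the generalized inverse at scale `n^(-1/3)`. -/
theorem exists_pi_lt_abs_genInv_sub_le (hA₁ : 0 < A₁) (hA₂ : 0 < A₂) (hA₃ : 0 < A₃) (hA₄ : 0 < A₄)
    (hκ : 0 < κ) :
    ∃ c : ℝ, 0 < c ∧ ∀ (ρ : Measure (ℝ × ℝ)) (m : ℝ → ℝ), IsRegressionModel A₁ A₂ A₃ A₄ κ ρ m →
      ∀ (n : ℕ) (H : (Fin n → ℝ × ℝ) → ℝ → ℝ), IsLSEFamily H → ∀ y a v : ℝ, 0 < y → y ^ 3 = n →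
      0 < v → Measure.pi (fun _ : Fin n => ρ) {w | v < |genInv (H w) a - genInv m a|} ≤
        ENNReal.ofReal (2 * Real.exp 1 * Real.exp (-(c * y * v))) := by
  obtain ⟨c₁, hc₁, hT⟩ := exists_pi_le_apply_add_le (A₂ := A₂) hA₁ hA₃ hA₄ hκ
  refine ⟨min c₁ 1, by positivity, ?_⟩
  intro ρ m hM n H hH y a v hy hyn hv
  have := hM.prob
  set c := min c₁ 1
  have hyv : 0 < y * v := by positivity
  have hexp : ENNReal.ofReal (Real.exp (-(c₁ * n * v ^ 3))) ≤
      ENNReal.ofReal (Real.exp (1 - c * y * v)) := by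
    refine ENNReal.ofReal_le_ofReal (Real.exp_le_exp.2 ?_)
    have h1 : c ≤ c₁ := min_le_left _ _
    have h2 : c ≤ 1 := min_le_right _ _
    have h3 : 0 < c := by positivity
    have h4 : c₁ * n * v ^ 3 = c₁ * (y * v) ^ 3 := by rw [← hyn]; ring
    rw [h4, mul_assoc c y v]
    rcases le_total (y * v) 1 with h | h
    · have : 0 ≤ c₁ * (y * v) ^ 3 := by positivity
      nlinarith
    · have h5 : y * v ≤ (y * v) ^ 3 := le_self_pow₀ h (by norm_num)
      have h6 : c * (y * v) ≤ c₁ * (y * v) ^ 3 := by gcongr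
      linarith
  have hanti : AntitoneOn m (Icc 0 1) := fun s hs t ht hst => by
    have := hM.le_sub s t hs.1 hst ht.2
    nlinarith
  set g := genInv m a with hg
  have hg01 : g ∈ Icc (0 : ℝ) 1 := genInv_mem
  have hright : Measure.pi (fun _ : Fin n => ρ) {w | g + v < genInv (H w) a} ≤
      ENNReal.ofReal (Real.exp (1 - c * y * v)) := by
    rcases le_or_gt (g + v) 1 with hgv | hgv
    · have hmg : m g ≤ a := by
        by_contra hlt
        push Not at hlt
        -- The bound by `v` keeps g + e in [0,1]; the other keeps `m` at least `a` there,
        -- contradicting that `g` is the supremum.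
        set e := min v ((m g - a) / A₂)
        have he : 0 < e := lt_min hv (div_pos (by linarith) hA₂)
        have h1 : e ≤ v := min_le_left _ _
        have h2 : A₂ * e ≤ m g - a := by
          calc _ ≤ A₂ * ((m g - a) / A₂) := by gcongr; exact min_le_right _ _
            _ = _ := by field_simp
        have h3 := hM.sub_le g (g + e) hg01.1 (by linarith) (by linarith)
        have h4 : g + e ≤ g := le_genInv (h := m) (a := a)
          ⟨by linarith [hg01.1], by linarith⟩ (by
            rw [add_sub_cancel_left] at h3
            linarith)
        linarith
      refine (measure_mono_ae ?_).trans ((hT ρ m hM n H hH g v a hg01.1 hv hgv hmg).trans hexp)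
      filter_upwards [hM.ae_pi_mem n] with w hw hwg
      exact le_of_lt_genInv (hH w hw).1.1 (by linarith [hg01.1]) hwg
    · have : {w | g + v < genInv (H w) a} = ∅ := by
        ext w
        have : genInv (H w) a ≤ 1 := genInv_mem.2
        simp only [mem_ofPred_eq, mem_empty_iff_false, iff_false, not_lt]
        linarith
      rw [this, measure_empty]
      exact bot_le
  have hleft : Measure.pi (fun _ : Fin n => ρ) {w | genInv (H w) a < g - v} ≤
      ENNReal.ofReal (Real.exp (1 - c * y * v)) := by
    rcases le_or_gt 0 (g - v) with hgv | hgv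
    · have hmg : a ≤ m g := by
        by_contra hlt
        push Not at hlt
        -- The factor 2 leaves `m` strictly below `a` at g - e, although this point precedes the
        -- inverse.
        set e := min v ((a - m g) / (2 * A₂))
        have he : 0 < e := lt_min hv (div_pos (by linarith) (by positivity))
        have h1 : e ≤ v := min_le_left _ _
        have h2 : A₂ * e ≤ (a - m g) / 2 := by
          calc _ ≤ A₂ * ((a - m g) / (2 * A₂)) := by gcongr; exact min_le_right _ _
            _ = _ := by field_simp
        have h3 := hM.sub_le (g - e) g (by linarith) (by linarith) hg01.2
        have h4 := le_of_lt_genInv hanti (s := g - e) (a := a) (by linarith) (by linarith)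
        rw [sub_sub_cancel] at h3
        linarith
      have h1 := hT _ _ hM.reflect n _ hH.reflect (1 - g) v (-a) (by linarith [hg01.2]) hv
        (by linarith) (by simpa using hmg)
      refine (measure_mono_ae ?_).trans ((pi_apply_le_le_reflect ρ H (g - v) a).trans
        ((measure_mono fun w hw => ?_).trans (h1.trans hexp)))
      · filter_upwards [hM.ae_pi_mem n] with w hw hwg
        by_contra hlt
        have hlt : a < H w (g - v) := not_le.1 hlt
        have hwg : genInv (H w) a < g - v := hwg
        have := le_genInv (h := H w) (a := a) (t := g - v) ⟨hgv, by linarith [hg01.2]⟩ hlt.le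
        linarith
      · simp only [mem_ofPred_eq] at hw ⊢
        rwa [show 1 - g + v = 1 - (g - v) by ring]
    · have : {w | genInv (H w) a < g - v} = ∅ := by
        ext w
        have : 0 ≤ genInv (H w) a := genInv_mem.1
        simp only [mem_ofPred_eq, mem_empty_iff_false, iff_false, not_lt]
        linarith
      rw [this, measure_empty]
      exact bot_le
  calc _ ≤ Measure.pi (fun _ : Fin n => ρ)
          ({w | g + v < genInv (H w) a} ∪ {w | genInv (H w) a < g - v}) := by
        refine measure_mono fun w hw => ?_
        rcases lt_abs.1 (show v < |genInv (H w) a - g| from hw) with h | h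
        · left; simp only [mem_ofPred_eq]; linarith
        · right; simp only [mem_ofPred_eq]; linarith
    _ ≤ ENNReal.ofReal (Real.exp (1 - c * y * v)) + ENNReal.ofReal (Real.exp (1 - c * y * v)) :=
        (measure_union_le _ _).trans (add_le_add hright hleft)
    _ = _ := by
        rw [← ENNReal.ofReal_add (by positivity) (by positivity), mul_assoc 2, ← Real.exp_add,
          ← two_mul, sub_eq_add_neg]

end IsRegressionModel

/-! ### From the hypotheses to the regression model -/

/-- The second-order Taylor remainder is absorbed by exponentials at ±2, whose conditional means are
bounded; the linear term will vanish for centred errors. -/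
theorem Real.exp_mul_le_of_abs_le_one {θ : ℝ} (hθ : |θ| ≤ 1) (e : ℝ) :
    Real.exp (θ * e) ≤ 1 + θ * e + 2 * θ ^ 2 * (Real.exp (2 * e) + Real.exp (-2 * e)) := by
  have h1 : Real.exp (θ * e) - (1 + θ * e) ≤ |θ * e| ^ 2 * Real.exp |θ * e| := by
    have h := Complex.norm_exp_sub_sum_le_norm_mul_exp ((θ * e : ℝ) : ℂ) 2
    rw [Complex.norm_real, Real.norm_eq_abs] at h
    have h2 : Complex.exp ((θ * e : ℝ) : ℂ) - ∑ i ∈ Finset.range 2,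
        ((θ * e : ℝ) : ℂ) ^ i / (i.factorial : ℂ) =
        ((Real.exp (θ * e) - (1 + θ * e) : ℝ) : ℂ) := by
      simp [Finset.sum_range_succ]
    rw [h2, Complex.norm_real, Real.norm_eq_abs] at h
    exact (le_abs_self _).trans h
  have h2 : |θ * e| ≤ |e| := by
    rw [abs_mul]
    exact mul_le_of_le_one_left (abs_nonneg e) hθ
  have h3 : |e| ^ 2 ≤ 2 * Real.exp |e| := by
    have := Real.quadratic_le_exp_of_nonneg (abs_nonneg e)
    nlinarith [abs_nonneg e]
  have h4 : Real.exp |e| * Real.exp |e| ≤ Real.exp (2 * e) + Real.exp (-2 * e) := by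
    rw [← Real.exp_add]
    rcases abs_cases e with ⟨h, _⟩ | ⟨h, _⟩
    · rw [h, ← two_mul]; linarith [Real.exp_nonneg (-2 * e)]
    · rw [h, show -e + -e = -2 * e by ring]; linarith [Real.exp_nonneg (2 * e)]
  have h5 : |θ * e| ^ 2 * Real.exp |θ * e| ≤ θ ^ 2 * (2 * Real.exp |e|) * Real.exp |e| := by
    have : |θ * e| ^ 2 = θ ^ 2 * |e| ^ 2 := by rw [abs_mul, mul_pow, sq_abs]
    rw [this]
    gcongr
  nlinarith [sq_nonneg θ]

section

variable {Ω : Type*} [MeasurableSpace Ω] {P : Measure Ω} [IsProbabilityMeasure P]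
  {X Y : Ω → ℝ} {μ : ℝ → ℝ}

/-- Centred errors with a sub-Gaussian moment generating function up to a constant factor are
sub-Gaussian without the factor. -/
theorem condExp_exp_mul_error_le {K α : ℝ} (hK : 0 < K) (hα : 0 < α) (hX : Measurable X)
    (hreg : IsRegressionFunction P X Y μ) (hsub : HasSubGaussianErrors P X Y μ K α) (θ : ℝ) :
    ∀ᵐ ω ∂P, (P[fun ω => Real.exp (θ * (Y ω - μ (X ω))) |
      MeasurableSpace.comap X inferInstance]) ω ≤
      Real.exp ((α + K + 4 * (K * Real.exp (4 * α))) * θ ^ 2) := by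
  have hm : MeasurableSpace.comap X inferInstance ≤ (inferInstance : MeasurableSpace Ω) :=
    hX.comap_le
  obtain ⟨hY, hYμ⟩ := hreg
  have hKe : 0 < K * Real.exp (4 * α) := by positivity
  -- For |θ| ≥ 1 the factor K is at most exp(Kθ²). For |θ| < 1 centring and the Taylor bound give 1
  -- + 4K exp(4α) θ², and 1 + x ≤ exp x finishes.
  rcases le_or_gt 1 |θ| with hθ | hθ
  · filter_upwards [(hsub θ).2] with ω hω
    refine hω.trans ?_
    have h1 : 1 ≤ θ ^ 2 := by rw [← sq_abs]; nlinarith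
    calc K * Real.exp (θ ^ 2 * α) ≤ Real.exp K * Real.exp (θ ^ 2 * α) := by
          gcongr; linarith [Real.add_one_le_exp K]
      _ = Real.exp (K + θ ^ 2 * α) := (Real.exp_add _ _).symm
      _ ≤ _ := by
          apply Real.exp_le_exp.2
          nlinarith
  · set 𝓜 : MeasurableSpace Ω := MeasurableSpace.comap X inferInstance with h𝓜
    have hμX : Integrable (fun ω => μ (X ω)) P := integrable_condExp.congr hYμ
    have hε : Integrable (fun ω => Y ω - μ (X ω)) P := hY.sub hμX
    have hε0 : P[fun ω => Y ω - μ (X ω) | 𝓜] =ᵐ[P] 0 := by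
      have h1 : P[fun ω => Y ω - μ (X ω) | 𝓜] =ᵐ[P] P[Y | 𝓜] - P[fun ω => μ (X ω) | 𝓜] :=
        condExp_sub hY hμX 𝓜
      have h2 : P[fun ω => μ (X ω) | 𝓜] =ᵐ[P] P[P[Y | 𝓜] | 𝓜] := condExp_congr_ae hYμ.symm
      have h3 : P[P[Y | 𝓜] | 𝓜] =ᵐ[P] P[Y | 𝓜] := condExp_condExp_of_le le_rfl hm
      filter_upwards [h1, h2, h3] with ω e1 e2 e3
      rw [e1, Pi.sub_apply, e2, e3]
      simp
    set E : ℝ → Ω → ℝ := fun s ω => Real.exp (s * (Y ω - μ (X ω))) with hE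
    have hEi : ∀ s, Integrable (E s) P := fun s => (hsub s).1
    have hle : E θ ≤ᵐ[P] ((fun _ => (1 : ℝ)) + θ • fun ω => Y ω - μ (X ω)) +
        (2 * θ ^ 2) • (E 2 + E (-2)) :=
      Filter.Eventually.of_forall fun ω => by
        simpa [hE, mul_add] using Real.exp_mul_le_of_abs_le_one hθ.le (Y ω - μ (X ω))
    have hi1 : Integrable ((fun _ => (1 : ℝ)) + θ • fun ω => Y ω - μ (X ω)) P :=
      (integrable_const _).add (hε.smul θ)
    have hi2 : Integrable (E 2 + E (-2)) P := (hEi 2).add (hEi (-2))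
    have c1 := condExp_mono (m := 𝓜) (hEi θ) (hi1.add (hi2.smul (2 * θ ^ 2))) hle
    have c2 := condExp_add hi1 (hi2.smul (2 * θ ^ 2)) 𝓜
    have c3 := condExp_add (integrable_const (1 : ℝ)) (hε.smul θ) (μ := P) 𝓜
    have c4 := condExp_smul θ (fun ω => Y ω - μ (X ω)) 𝓜 (μ := P)
    have c5 := condExp_smul (2 * θ ^ 2) (E 2 + E (-2)) 𝓜 (μ := P)
    have c6 := condExp_add (hEi 2) (hEi (-2)) 𝓜
    filter_upwards [c1, c2, c3, c4, c5, c6, hε0, (hsub 2).2, (hsub (-2)).2]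
      with ω e1 e2 e3 e4 e5 e6 e7 e8 e9
    refine e1.trans ?_
    rw [e2, Pi.add_apply, e3, Pi.add_apply, e4, Pi.smul_apply, e7, e5, Pi.smul_apply, e6,
      Pi.add_apply, condExp_const hm]
    have e8' : (P[E 2 | 𝓜]) ω ≤ K * Real.exp (4 * α) := by convert e8 using 3; norm_num
    have e9' : (P[E (-2) | 𝓜]) ω ≤ K * Real.exp (4 * α) := by convert e9 using 3; norm_num
    simp only [Pi.zero_apply, smul_eq_mul, mul_zero, add_zero]
    have h1 := Real.add_one_le_exp ((α + K + 4 * (K * Real.exp (4 * α))) * θ ^ 2)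
    have hθ2 := sq_nonneg θ
    nlinarith [mul_nonneg hα.le hθ2, mul_nonneg hK.le hθ2,
      mul_le_mul_of_nonneg_left (add_le_add e8' e9') (by positivity : 0 ≤ 2 * θ ^ 2)]

/-- Bounds on derivative and density become increment and interval bounds, by the mean value
inequality and integration. Clamping the argument to [0,1] makes μ antitone on the whole line, hence
measurable, without changing it on [0,1]. -/
theorem isRegressionModel_map {A₁ A₂ A₃ A₄ K α : ℝ} {f : ℝ → ℝ} (hA₃ : 0 < A₃) (hK : 0 < K)
    (hα : 0 < α) (hX : Measurable X) (hY : Measurable Y)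
    (hf : HasUnitDensity P X f) (hreg : IsRegressionFunction P X Y μ)
    (hsub : HasSubGaussianErrors P X Y μ K α) (hanti : AntitoneOn μ (Icc 0 1))
    (hdiff : DifferentiableOn ℝ μ (Icc 0 1))
    (hμ' : ∀ t ∈ Icc (0 : ℝ) 1, A₁ < |derivWithin μ (Icc 0 1) t| ∧ |derivWithin μ (Icc 0 1) t| < A₂)
    (hfb : ∀ t ∈ Icc (0 : ℝ) 1, A₃ < f t ∧ f t < A₄) :
    IsRegressionModel A₁ A₂ A₃ A₄ (α + K + 4 * (K * Real.exp (4 * α)))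
      (P.map fun ω => (X ω, Y ω)) (fun x => μ (max 0 (min 1 x))) := by
  have hXY : Measurable fun ω => (X ω, Y ω) := hX.prodMk hY
  set m : ℝ → ℝ := fun x => μ (max 0 (min 1 x)) with hmd
  have hmμ : ∀ x ∈ Icc (0 : ℝ) 1, m x = μ x := fun x hx => by
    simp only [hmd]
    rw [min_eq_right hx.2, max_eq_right hx.1]
  have hclamp : ∀ x : ℝ, max 0 (min 1 x) ∈ Icc (0 : ℝ) 1 := fun x =>
    ⟨le_max_left _ _, max_le zero_le_one (min_le_left _ _)⟩
  have hm : Measurable m := Antitone.measurable fun s t hst =>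
    hanti (hclamp s) (hclamp t) (max_le_max_left _ (min_le_min_left _ hst))
  have hX01 : ∀ᵐ ω ∂P, X ω ∈ Icc (0 : ℝ) 1 := by
    refine ae_of_ae_map hX.aemeasurable ?_
    rw [hf.2]
    exact (withDensity_absolutelyContinuous _ _).ae_le (ae_restrict_mem measurableSet_Icc)
  have hint : ∀ a b : ℝ, 0 ≤ a → b ≤ 1 → (P.map fun ω => (X ω, Y ω)) (Prod.fst ⁻¹' Icc a b) =
      ∫⁻ t in Icc a b, ENNReal.ofReal (f t) := by
    intro a b ha hb
    rw [Measure.map_apply hXY (measurable_fst measurableSet_Icc)]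
    have h1 : P.map X (Icc a b) = P ((fun ω => (X ω, Y ω)) ⁻¹' (Prod.fst ⁻¹' Icc a b)) :=
      Measure.map_apply hX measurableSet_Icc
    rw [← h1, hf.2, withDensity_apply _ measurableSet_Icc,
      Measure.restrict_restrict_of_subset (Icc_subset_Icc ha hb)]
  have hprob : IsProbabilityMeasure (P.map fun ω => (X ω, Y ω)) :=
    Measure.isProbabilityMeasure_map hXY.aemeasurable
  have hderiv : ∀ t ∈ interior (Icc (0 : ℝ) 1), -A₂ ≤ deriv μ t ∧ deriv μ t ≤ -A₁ := by
    intro t ht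
    have h1 : derivWithin μ (Icc 0 1) t ≤ 0 := hanti.derivWithin_nonpos
    have h2 := hμ' t (interior_subset ht)
    rw [abs_of_nonpos h1, derivWithin_of_mem_nhds (mem_interior_iff_mem_nhds.1 ht)] at h2
    constructor <;> linarith [h2.1, h2.2]
  refine ⟨hprob, ?_, ?_, ?_, hm, ?_, ?_, ?_⟩
  · rw [ae_map_iff hXY.aemeasurable (measurable_fst measurableSet_Icc)]
    exact hX01
  · intro a b ha hab hb
    have hA₄ : 0 ≤ A₄ := by
      have := hfb 0 ⟨le_rfl, zero_le_one⟩
      linarith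
    rw [measureReal_def, hint a b ha hb]
    refine ENNReal.toReal_le_of_le_ofReal (mul_nonneg hA₄ (by linarith)) ?_
    calc _ ≤ ∫⁻ _ in Icc a b, ENNReal.ofReal A₄ :=
          setLIntegral_mono' measurableSet_Icc fun t ht =>
            ENNReal.ofReal_le_ofReal (hfb t ⟨ha.trans ht.1, ht.2.trans hb⟩).2.le
      _ = _ := by
          rw [setLIntegral_const, Real.volume_Icc, ENNReal.ofReal_mul hA₄]
  · intro a b ha hab hb
    have h1 : ENNReal.ofReal (A₃ * (b - a)) ≤
        (P.map fun ω => (X ω, Y ω)) (Prod.fst ⁻¹' Icc a b) := by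
      rw [hint a b ha hb]
      calc _ = ∫⁻ _ in Icc a b, ENNReal.ofReal A₃ := by
            rw [setLIntegral_const, Real.volume_Icc, ENNReal.ofReal_mul hA₃.le]
        _ ≤ _ := setLIntegral_mono' measurableSet_Icc fun t ht =>
            ENNReal.ofReal_le_ofReal (hfb t ⟨ha.trans ht.1, ht.2.trans hb⟩).1.le
    exact (ENNReal.ofReal_le_iff_le_toReal (measure_ne_top _ _)).1 h1
  · intro s t hs hst ht
    have h1 := (convex_Icc (0 : ℝ) 1).image_sub_le_mul_sub_of_deriv_le hdiff.continuousOn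
      (hdiff.mono interior_subset) (fun t ht => (hderiv t ht).2) s ⟨hs, hst.trans ht⟩ t
      ⟨hs.trans hst, ht⟩ hst
    rw [hmμ s ⟨hs, hst.trans ht⟩, hmμ t ⟨hs.trans hst, ht⟩]
    linarith
  · intro s t hs hst ht
    have h1 := (convex_Icc (0 : ℝ) 1).mul_sub_le_image_sub_of_le_deriv hdiff.continuousOn
      (hdiff.mono interior_subset) (fun t ht => (hderiv t ht).1) s ⟨hs, hst.trans ht⟩ t
      ⟨hs.trans hst, ht⟩ hst
    rw [hmμ s ⟨hs, hst.trans ht⟩, hmμ t ⟨hs.trans hst, ht⟩]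
    linarith
  · intro θ B hB
    set κ := α + K + 4 * (K * Real.exp (4 * α))
    have hi : Integrable (fun ω => Real.exp (θ * (Y ω - μ (X ω)))) P := (hsub θ).1
    have hXB : MeasurableSet[MeasurableSpace.comap X inferInstance] (X ⁻¹' B) := ⟨B, hB, rfl⟩
    rw [setLIntegral_map (measurable_fst hB) (by fun_prop) hXY,
      Measure.map_apply hXY (measurable_fst hB)]
    change ∫⁻ ω in X ⁻¹' B, ENNReal.ofReal (Real.exp (θ * (Y ω - m (X ω)))) ∂P ≤
      ENNReal.ofReal (Real.exp (κ * θ ^ 2)) * P (X ⁻¹' B)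
    calc _ = ∫⁻ ω in X ⁻¹' B, ENNReal.ofReal (Real.exp (θ * (Y ω - μ (X ω)))) ∂P := by
          refine lintegral_congr_ae (ae_restrict_of_ae ?_)
          filter_upwards [hX01] with ω hω
          rw [hmμ _ hω]
      _ = ENNReal.ofReal (∫ ω in X ⁻¹' B, Real.exp (θ * (Y ω - μ (X ω))) ∂P) :=
          (ofReal_integral_eq_lintegral_ofReal hi.integrableOn
            (Filter.Eventually.of_forall fun _ => Real.exp_nonneg _)).symm
      _ = ENNReal.ofReal (∫ ω in X ⁻¹' B, (P[fun ω => Real.exp (θ * (Y ω - μ (X ω))) |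
            MeasurableSpace.comap X inferInstance]) ω ∂P) := by
          rw [setIntegral_condExp hX.comap_le hi hXB]
      _ ≤ ENNReal.ofReal (∫ ω in X ⁻¹' B, Real.exp (κ * θ ^ 2) ∂P) := by
          refine ENNReal.ofReal_le_ofReal (integral_mono_ae integrable_condExp.integrableOn
            (integrable_const _) (ae_restrict_of_ae ?_))
          exact condExp_exp_mul_error_le hK hα hX hreg hsub θ
      _ = _ := by
          rw [setIntegral_const, smul_eq_mul, mul_comm, ENNReal.ofReal_mul (Real.exp_nonneg _),
            ofReal_measureReal]

end

/-! ### Moment bounds for the sample -/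

theorem theorem4p1 (p A₁ A₂ A₃ A₄ A₅ K α : ℝ) (hp : 1 ≤ p)
    (hA₁ : 0 < A₁) (hA₂ : 0 < A₂) (hA₃ : 0 < A₃) (hA₄ : 0 < A₄) (hA₅ : 0 < A₅)
    (hK : 0 < K) (hα : 0 < α) :
    ∃ Kp : ℝ, 0 < Kp ∧
      ∀ (Ω : Type*) [MeasurableSpace Ω] (P : Measure Ω) [IsProbabilityMeasure P]
        (X Y : Ω → ℝ) (f μ : ℝ → ℝ),
        Measurable X → Measurable Y →
        HasUnitDensity P X f →
        IsRegressionFunction P X Y μ →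
        HasSubGaussianErrors P X Y μ K α →
        AntitoneOn μ (Icc 0 1) →
        DifferentiableOn ℝ μ (Icc 0 1) →
        (∀ t ∈ Icc (0 : ℝ) 1,
          (A₁ < |derivWithin μ (Icc 0 1) t| ∧ |derivWithin μ (Icc 0 1) t| < A₂) ∧
          (A₃ < f t ∧ f t < A₄) ∧ |μ t| ≤ A₅) →
        ∀ n : ℕ, 1 ≤ n → ∀ W : Fin n → Ω → ℝ × ℝ, IsIIDSample P X Y W →
          (∀ a : ℝ,
            Integrable (fun ω => |genInv (muHat W ω) a - genInv μ a| ^ p) P ∧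
            ∫ ω, |genInv (muHat W ω) a - genInv μ a| ^ p ∂P ≤ Kp * (n : ℝ) ^ (-p / 3)) ∧
          (∀ t ∈ Icc ((n : ℝ) ^ (-(1 : ℝ) / 3)) (1 - (n : ℝ) ^ (-(1 : ℝ) / 3)),
            Integrable (fun ω => |muHat W ω t - μ t| ^ p) P ∧
            ∫ ω, |muHat W ω t - μ t| ^ p ∂P ≤ Kp * (n : ℝ) ^ (-p / 3)) := by
  have hp0 : 0 < p := by linarith
  have hκ : 0 < α + K + 4 * (K * Real.exp (4 * α)) := by positivity
  obtain ⟨c₁, hc₁, hT₁⟩ := IsRegressionModel.exists_pi_lt_abs_genInv_sub_le hA₁ hA₂ hA₃ hA₄ hκ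
  obtain ⟨c₂, hc₂, hT₂⟩ := IsRegressionModel.exists_pi_lt_abs_apply_sub_le hA₁ hA₂ hA₃ hA₄ hκ
  -- The layer-cake bound for a tail 2e·exp(-c y z), with the factor y^(-p) = n^(-p/3) removed;
  -- adding the two constants serves both claims.
  set C : ℝ → ℝ := fun c => p * (2 * Real.exp 1 * ((1 / c) ^ p * Real.Gamma p)) with hC
  have hC0 : ∀ c, 0 < c → 0 < C c := fun c hc => by
    have := Real.Gamma_pos_of_pos hp0
    positivity
  refine ⟨C c₁ + C c₂, add_pos (hC0 _ hc₁) (hC0 _ hc₂), ?_⟩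
  intro Ω _ P _ X Y f μ hX hY hf hreg hsub hanti hdiff hb n hn W hW
  have hM := isRegressionModel_map hA₃ hK hα hX hY hf hreg hsub hanti hdiff
    (fun t ht => (hb t ht).1) (fun t ht => (hb t ht).2.1)
  set m : ℝ → ℝ := fun x => μ (max 0 (min 1 x)) with hmd
  set ρ := P.map fun ω => (X ω, Y ω) with hρ
  have hprob := hM.prob
  have hmμ : ∀ x ∈ Icc (0 : ℝ) 1, m x = μ x := fun x hx => by
    simp only [hmd]
    rw [min_eq_right hx.2, max_eq_right hx.1]
  have hgen : ∀ a, genInv μ a = genInv m a := fun a => by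
    refine congrArg sSup (Set.ext fun t => and_congr_right fun ht => ?_)
    rw [hmμ t ht]
  have hWm : ∀ i, AEMeasurable (W i) P := fun i => (hW.2 i).aemeasurable_fst
  have hWm' : AEMeasurable (fun ω i => W i ω) P := aemeasurable_pi_lambda _ hWm
  have hlaw : P.map (fun ω i => W i ω) = Measure.pi fun _ : Fin n => ρ := by
    rw [hW.1.map_fun_eq_pi_map hWm]
    exact congrArg Measure.pi (funext fun i => (hW.2 i).map_eq)
  set y : ℝ := (n : ℝ) ^ ((1 : ℝ) / 3) with hy
  have hn0 : (0 : ℝ) < n := by exact_mod_cast hn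
  have hy0 : 0 < y := Real.rpow_pos_of_pos hn0 _
  have hy3 : y ^ 3 = n := by
    rw [hy, ← Real.rpow_natCast, ← Real.rpow_mul hn0.le]
    norm_num
  have hyi : (n : ℝ) ^ (-(1 : ℝ) / 3) = 1 / y := by
    rw [hy, neg_div, Real.rpow_neg hn0.le, one_div (_ ^ _)]
  have hyp : ∀ c, 0 < c → p * (2 * Real.exp 1 * ((1 / (c * y)) ^ p * Real.Gamma p)) =
      C c * (n : ℝ) ^ (-p / 3) := fun c hc => by
    have h1 : (1 / (c * y)) ^ p = (1 / c) ^ p * (n : ℝ) ^ (-p / 3) := by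
      rw [← one_div_mul_one_div, Real.mul_rpow (by positivity) (by positivity),
        ← hyi, ← Real.rpow_mul hn0.le]
      congr 2; ring
    rw [h1, hC]; ring
  have transfer : ∀ (Z : (Fin n → ℝ × ℝ) → ℝ) (c : ℝ), 0 < c → C c ≤ C c₁ + C c₂ →
      AEMeasurable Z (Measure.pi fun _ : Fin n => ρ) → (∀ w, 0 ≤ Z w) →
      (∀ z, 0 < z → Measure.pi (fun _ : Fin n => ρ) {w | z < Z w} ≤
        ENNReal.ofReal (2 * Real.exp 1 * Real.exp (-(c * y * z)))) →
      Integrable (fun ω => Z (fun i => W i ω) ^ p) P ∧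
        ∫ ω, Z (fun i => W i ω) ^ p ∂P ≤ (C c₁ + C c₂) * (n : ℝ) ^ (-p / 3) := by
    intro Z c hc hcC hZ hZ0 htail
    obtain ⟨h1, h2⟩ := integrable_rpow_of_exp_tail hZ hZ0 hp0 (by positivity)
      (mul_pos hc hy0) htail
    rw [hyp c hc] at h2
    rw [← hlaw] at h1 h2
    refine ⟨(integrable_map_measure h1.aestronglyMeasurable hWm').1 h1, ?_⟩
    rw [integral_map hWm' h1.aestronglyMeasurable] at h2
    exact h2.trans (by gcongr)
  have hgood := hM.ae_pi_mem n
  constructor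
  · intro a
    rw [hgen a]
    exact transfer (fun w => |genInv (lseOfData w) a - genInv m a|) c₁ hc₁
      (by linarith [hC0 c₂ hc₂])
      (((aemeasurable_genInv_lseOfData hn a hgood).sub_const _).abs)
      (fun _ => abs_nonneg _)
      (fun z hz => hT₁ ρ m hM n _ (isLSEFamily_lseOfData hn) y a z hy0 hy3 hz)
  · intro t ht
    rw [hyi] at ht
    have hy1 : 0 < 1 / y := by positivity
    have ht01 : t ∈ Icc (0 : ℝ) 1 := ⟨by linarith [ht.1], by linarith [ht.2]⟩
    rw [← hmμ t ht01]
    exact transfer (fun w => |lseOfData w t - m t|) c₂ hc₂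
      (by linarith [hC0 c₁ hc₁])
      (((aemeasurable_lseOfData hn ht01 hgood).sub_const _).abs)
      (fun _ => abs_nonneg _)
      (fun z hz => hT₂ ρ m hM n _ (isLSEFamily_lseOfData hn) y t z hy0 hy3 ht.1 ht.2 hz)
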